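/- Let $q$ be an odd prime. Let $\alpha(q)$ be the residue at $s=1$ of the Dedekind zeta function of the cyclotomic field $\mathbb{Q}(\zeta_q)$ and let $\gamma$ be Euler's constant. Put $\omega=e^{2\pi i/(q-1)}$. For a primitive root $g$ modulo $q$ let $\chi_g$ be the character modulo $q$ with $\chi_g(n)=\omega^{\mathrm{ind}_g(n)}$ for $q\nmid n$, where $n\equiv g^{\mathrm{ind}_g(n)} \pmod q$, and $\chi_g(n)=0$ for $q\mid n$. Put $$C(q)=\prod_{r=1}^{q-2}\ \prod_{p:\ \chi_g(p)=\omega^r}\Big(1-\frac{1}{p^{(q-1)/(r,q-1)}}\Big)^{(r,q-1)},$$ where $p$ runs over primes and $(r,q-1)$ is the greatest common divisor. This constant does not depend on the choice of $g$; indeed $$C(q)=\prod_{p\ne q,\ f_p\ge 2}\Big(1-\frac{1}{p^{f_p}}\Big)^{(q-1)/f_p},$$ where $f_p$ denotes the least integer $k\ge 1$ with $p^k\equiv 1 \pmod q$. Moreover, for all real $x\ge 2$, $$\prod_{\substack{p\le x\\ p\equiv 1\,(\mathrm{mod}\ q)}}\Big(1-\frac1p\Big)=\Big(\frac{q\,e^{-\gamma}}{(q-1)\,\alpha(q)\,C(q)\,\log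 x}\Big)^{\frac1{q-1}}\Big(1+O_q\Big(\frac1{\log x}\Big)\Big),$$ where $p$ runs over primes and the implied constant depends only on $q$. -/

import Mathlib

namespace MertensAP

open Filter Topology

/-- The product of `1 - 1/p` over the primes `p ≤ x` with `p ≡ 1 (mod q)`. -/
noncomputable def primeProduct (q : ℕ) (x : ℝ) : ℝ :=
  ∏ p ∈ (Finset.Iic ⌊x⌋₊).filter (fun p : ℕ => p.Prime ∧ p ≡ 1 [MOD q]), (1 - 1 / (p : ℝ))

/-- The residue at `s = 1` of the Dedekind zeta function of `ℚ(ζ_q)`: the zeta function has a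
simple pole at `s = 1`, so this is the limit of `(s - 1) ζ_K(s)` as `s` tends to `1` from the
right. -/
noncomputable def alpha (q : ℕ) : ℝ :=
  (limUnder (𝓝[>] (1 : ℝ)) fun s : ℝ =>
    ((s : ℂ) - 1) * NumberField.dedekindZeta (CyclotomicField q ℚ) s).re

/-- The limit that defines `alpha q` exists; it is the value in the class number formula. -/
theorem alpha_eq (q : ℕ) :
    alpha q = NumberField.dedekindZeta_residue (CyclotomicField q ℚ) := by
  unfold alpha
  rw [(NumberField.tendsto_sub_one_mul_dedekindZeta_nhdsGT (CyclotomicField q ℚ)).limUnder_eq]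
  exact Complex.ofReal_re _

theorem tendsto_alpha (q : ℕ) :
    Tendsto (fun s : ℝ => ((s : ℂ) - 1) * NumberField.dedekindZeta (CyclotomicField q ℚ) s)
      (𝓝[>] (1 : ℝ)) (𝓝 (alpha q : ℂ)) := by
  rw [alpha_eq]
  exact NumberField.tendsto_sub_one_mul_dedekindZeta_nhdsGT (CyclotomicField q ℚ)

/-- The index of `n` with respect to `g` modulo `q`: the least `k` with `n ≡ g ^ k (mod q)`
(meaningful if `g` is a primitive root modulo `q` and `q ∤ n`). -/
noncomputable def ind (q g n : ℕ) : ℕ := sInf {k : ℕ | n ≡ g ^ k [MOD q]}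

/-- `ω = exp (2 π i / (q - 1))`. -/
noncomputable def omega (q : ℕ) : ℂ := Complex.exp (2 * Real.pi * Complex.I / ((q : ℂ) - 1))

/-- The character `χ_g` modulo `q` attached to a primitive root `g`: `χ_g(n) = ω ^ ind_g(n)` if
`q ∤ n`, and `0` otherwise. -/
noncomputable def chi (q g n : ℕ) : ℂ := if q ∣ n then 0 else omega q ^ ind q g n

/-- `C(q, r, χ_g)`: the product of `1 - p ^ (-(q-1)/(r, q-1))` over the primes `p` with
`χ_g(p) = ω ^ r`. -/
noncomputable def Cr (q g r : ℕ) : ℝ :=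
  ∏' p : {p : ℕ // p.Prime ∧ chi q g p = omega q ^ r},
    (1 - 1 / (p.1 : ℝ) ^ ((q - 1) / Nat.gcd r (q - 1)))

/-- The constant `C(q)`, computed from a primitive root `g` modulo `q`. -/
noncomputable def C (q g : ℕ) : ℝ :=
  ∏ r ∈ Finset.Icc 1 (q - 2), Cr q g r ^ Nat.gcd r (q - 1)

/-- The least `k ≥ 1` with `p ^ k ≡ 1 (mod q)`. -/
noncomputable def f (q p : ℕ) : ℕ := orderOf (p : ZMod q)

/-- The constant `C(q, 1)`: the product of `(1 - p ^ (-f_p)) ^ ((q-1)/f_p)` over the primes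
`p ≠ q` with `f_p ≥ 2`. -/
noncomputable def C1 (q : ℕ) : ℝ :=
  ∏' p : {p : ℕ // p.Prime ∧ p ≠ q ∧ 2 ≤ f q p},
    (1 - 1 / (p.1 : ℝ) ^ f q p) ^ ((q - 1) / f q p)

/-- Auxiliary comparison used for the convergence of the infinite products. -/
theorem multipliable_aux (S : Set ℕ) (hS : ∀ p ∈ S, 2 ≤ p) (a k : S → ℕ) (ha : ∀ p, 2 ≤ a p)
    (B : ℕ) (hk : ∀ p, k p ≤ B) :
    Multipliable fun p : S => (1 - 1 / ((p : ℕ) : ℝ) ^ a p) ^ k p := by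
  have hs : Summable fun p : S => ‖(1 - 1 / ((p : ℕ) : ℝ) ^ a p) ^ k p - 1‖ := by
    have h2 : Summable fun p : S => (B : ℝ) * (1 / ((p : ℕ) : ℝ) ^ 2) :=
      ((Real.summable_one_div_nat_pow.2 one_lt_two).subtype S).mul_left _
    refine Summable.of_nonneg_of_le (fun _ => norm_nonneg _) (fun p => ?_) h2
    have hp : (2 : ℝ) ≤ ((p : ℕ) : ℝ) := by exact_mod_cast hS p p.2
    have hy0 : 0 ≤ 1 / ((p : ℕ) : ℝ) ^ a p := by positivity
    have hy2 : 1 / ((p : ℕ) : ℝ) ^ a p ≤ 1 / ((p : ℕ) : ℝ) ^ 2 :=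
      one_div_le_one_div_of_le (by positivity) (pow_le_pow_right₀ (by linarith) (ha p))
    have hy1 : 1 / ((p : ℕ) : ℝ) ^ a p ≤ 1 := by
      rw [div_le_one (by positivity)]
      exact one_le_pow₀ (by linarith)
    set y := 1 / ((p : ℕ) : ℝ) ^ a p with hy
    have hle : (1 - y) ^ k p ≤ 1 := pow_le_one₀ (by linarith) (by linarith)
    have hber := one_add_mul_le_pow (a := -y) (by linarith) (k p)
    rw [← sub_eq_add_neg] at hber
    rw [Real.norm_eq_abs, abs_sub_comm, abs_of_nonneg (by linarith)]
    have hkB : (k p : ℝ) ≤ B := by exact_mod_cast hk p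
    calc 1 - (1 - y) ^ k p ≤ k p * y := by linarith
      _ ≤ B * (1 / ((p : ℕ) : ℝ) ^ 2) := by gcongr
  simpa using multipliable_one_add_of_summable hs

/-- The product that defines `C1 q` converges unconditionally. -/
theorem multipliable_C1 (q : ℕ) :
    Multipliable fun p : {p : ℕ // p.Prime ∧ p ≠ q ∧ 2 ≤ f q p} =>
      (1 - 1 / (p.1 : ℝ) ^ f q p) ^ ((q - 1) / f q p) :=
  multipliable_aux {p : ℕ | p.Prime ∧ p ≠ q ∧ 2 ≤ f q p} (fun _ hp => hp.1.two_le)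
    (fun p => f q p) (fun p => (q - 1) / f q p) (fun p => p.2.2.2) (q - 1)
    (fun _ => Nat.div_le_self _ _)

/-- The products that define `C q g` converge unconditionally. -/
theorem multipliable_Cr (q g r : ℕ) (hr : r ∈ Finset.Icc 1 (q - 2)) :
    Multipliable fun p : {p : ℕ // p.Prime ∧ chi q g p = omega q ^ r} =>
      (1 - 1 / (p.1 : ℝ) ^ ((q - 1) / Nat.gcd r (q - 1))) := by
  rw [Finset.mem_Icc] at hr
  have hd : 2 ≤ (q - 1) / Nat.gcd r (q - 1) := by
    have h1 : 0 < Nat.gcd r (q - 1) := Nat.gcd_pos_of_pos_left _ (by omega)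
    have h2 : Nat.gcd r (q - 1) ≤ r := Nat.gcd_le_left _ (by omega)
    obtain ⟨c, hc⟩ := Nat.gcd_dvd_right r (q - 1)
    have hc2 : 2 ≤ c := by
      rcases c with _ | _ | c
      · omega
      · omega
      · omega
    calc 2 ≤ c := hc2
      _ = (q - 1) / Nat.gcd r (q - 1) := (Nat.div_eq_of_eq_mul_right h1 hc).symm
  have h := multipliable_aux {p : ℕ | p.Prime ∧ chi q g p = omega q ^ r}
    (fun _ hp => hp.1.two_le) (fun _ => (q - 1) / Nat.gcd r (q - 1)) (fun _ => 1)
    (fun _ => hd) 1 (fun _ => le_rfl)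
  simp only [pow_one] at h
  exact h

end MertensAP

/-!
Let `K = ℚ(ζ_q)`. The product over `p ≤ x`, `p ≡ 1 (mod q)`, is `exp (-∑ w(p))` for the weights
`w(p) = -log (1 - 1/p)` (`primeWeight`), so the claim is an asymptotic formula
`∑_{p ≤ x} w(p) = log log x / (q - 1) + M + O(1 / log x)` together with the value of `M`.

*Existence of `M`.* For a nontrivial character `χ` modulo `q`, Abel's inequality bounds the distance
of `∑_{n ≤ N} χ(n)/n` from `L(1, χ)` by `O(1/N)`. Together with `Λ * 1 = log`, Chebyshev's bound and
`L(1, χ) ≠ 0` this shows that `∑_{n ≤ N} χ(n) Λ(n)/n` is bounded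
(`exists_norm_sum_character_mul_vonMangoldt_div_le`). Orthogonality turns this into Mertens' first
theorem in the residue class `1` (`exists_abs_sum_residueClass_div_sub_log_le`), and partial
summation gives the formula above (`exists_abs_sum_primeWeight_sub_le`). No zero-free region and no
prime number theorem is involved, because only an error `O(1 / log x)` is asked for.

*Value of `M`.* An Abelian theorem (`tendsto_tsum_mul_rpow_sub_log`) translates the formula into
`∑ w(p) p ^ (-δ) = log (1/δ) / (q - 1) + M - γ / (q - 1) + o(1)` as `δ → 0+`, where `γ` comes
from `H_m - log m`. On the other hand `log ζ_K(1 + δ) = log (1/δ) + log α(q) + o(1)`, and the Euler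
product of `ζ_K` expresses `log ζ_K(1 + δ)` through rational primes. A prime `p ≠ q` has
`(q - 1) / f_p` primes above it, each of norm `p ^ f_p`, and `q` has a single one, of norm `q`
(`localFactor_cyclotomic`, `localFactor_cyclotomic_self`); hence the primes `p ≡ 1` contribute
`(q - 1) ∑ w(p) p ^ (-δ) + o(1)`, the prime `q` contributes `-log (1 - 1/q) + o(1)`, and the
remaining primes contribute `-log C(q) + o(1)`. Comparing the two expansions gives
`(q - 1) M = γ + log α(q) + log (1 - 1/q) + log C(q)` (`mertens_constant`).

The Euler product is obtained by sieving: removing from the ideals of `𝓞 K` the multiples of one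
prime after another multiplies the sum of `N(I) ^ (-s)` by the Euler factors, and what is left after
all primes above `p < N` have been removed tends to `1` (`tendsto_prod_localFactor_mul`).

The two expressions for `C(q)` agree because the index of `p` with respect to a primitive root
determines `f_p = (q - 1) / (ind p, q - 1)` (`C_eq_C1`).
-/

namespace MertensAP

open Filter Topology Finset

/-! ### Partial sums of nontrivial Dirichlet characters -/

/-- **Abel's inequality**: a bounded factor `D` on all block sums of `a` passes to the sums of `a`
weighted by a nonnegative antitone sequence. -/
theorem norm_sum_Ico_mul_le {a : ℕ → ℂ} {g : ℕ → ℝ} {D : ℝ} {m n : ℕ} (hmn : m ≤ n)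
    (hD : ∀ k l, ‖∑ i ∈ Ico k l, a i‖ ≤ D) (hg : ∀ k, m ≤ k → g (k + 1) ≤ g k)
    (hg0 : ∀ k, m ≤ k → 0 ≤ g k) :
    ‖∑ k ∈ Ico m n, (g k : ℂ) * a k‖ ≤ D * g m := by
  have key : ∑ k ∈ Ico m n, (g k : ℂ) * a k = g n * ∑ i ∈ Ico m n, a i +
      ∑ k ∈ Ico m n, ((g k - g (k + 1) : ℝ) : ℂ) * ∑ i ∈ Ico m (k + 1), a i := by
    induction n, hmn using Nat.le_induction with
    | base => simp
    | succ n hn ih =>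
      simp only [sum_Ico_succ_top hn, ih]
      push_cast
      ring
  have tele : ∑ k ∈ Ico m n, (g k - g (k + 1)) = g m - g n := by
    clear key
    induction n, hmn using Nat.le_induction with
    | base => simp
    | succ n hn ih =>
      rw [sum_Ico_succ_top hn, ih]
      ring
  rw [key]
  calc _ ≤ ‖(g n : ℂ) * ∑ i ∈ Ico m n, a i‖ +
        ∑ k ∈ Ico m n, ‖((g k - g (k + 1) : ℝ) : ℂ) * ∑ i ∈ Ico m (k + 1), a i‖ :=
        (norm_add_le _ _).trans (by gcongr; exact norm_sum_le _ _)
    _ ≤ g n * D + ∑ k ∈ Ico m n, (g k - g (k + 1)) * D := by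
        gcongr with k hk
        · rw [norm_mul, Complex.norm_real, Real.norm_of_nonneg (hg0 n hmn)]
          exact mul_le_mul_of_nonneg_left (hD _ _) (hg0 n hmn)
        · have h := sub_nonneg.2 (hg k (mem_Ico.1 hk).1)
          rw [norm_mul, Complex.norm_real, Real.norm_of_nonneg h]
          exact mul_le_mul_of_nonneg_left (hD _ _) h
    _ = D * g m := by rw [← sum_mul, tele]; ring

variable {q : ℕ} [NeZero q]

theorem sum_Ico_add_character_eq_zero {χ : DirichletCharacter ℂ q} (hχ : χ ≠ 1) (k : ℕ) :
    ∑ i ∈ Ico k (k + q), χ i = 0 := by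
  have h0 : ∑ i ∈ range q, χ (i : ZMod q) = 0 := by
    have := MulChar.sum_eq_zero_of_ne_one hχ
    rw [← this]
    refine sum_bij (fun i _ => (i : ZMod q)) (fun _ _ => mem_univ _) ?_ ?_ (fun _ _ => rfl)
    · intro i hi j hj hij
      rw [ZMod.natCast_eq_natCast_iff'] at hij
      rwa [Nat.mod_eq_of_lt (mem_range.1 hi), Nat.mod_eq_of_lt (mem_range.1 hj)] at hij
    · intro b _
      exact ⟨b.val, mem_range.2 (ZMod.val_lt b), by simp⟩
  induction k with
  | zero => simpa using h0
  | succ k ih =>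
    have hq : 0 < q := Nat.pos_of_neZero q
    have e1 := sum_Ico_succ_top (show k ≤ k + q by omega) (fun i : ℕ => χ (i : ZMod q))
    have e2 := sum_eq_sum_Ico_succ_bot (show k < k + q + 1 by omega) (fun i : ℕ => χ (i : ZMod q))
    rw [e1, ih] at e2
    have e3 : ((k + q : ℕ) : ZMod q) = k := by simp
    rw [e3, zero_add] at e2
    rw [show k + 1 + q = k + q + 1 by ring]
    simpa using e2

theorem norm_sum_Ico_character_le {χ : DirichletCharacter ℂ q} (hχ : χ ≠ 1) (k l : ℕ) :
    ‖∑ i ∈ Ico k l, χ i‖ ≤ q := by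
  by_cases h : l < k + q
  · calc _ ≤ ∑ i ∈ Ico k l, ‖χ i‖ := norm_sum_le _ _
      _ ≤ ∑ i ∈ Ico k l, (1 : ℝ) := sum_le_sum fun i _ => χ.norm_le_one _
      _ = (l - k : ℕ) := by simp
      _ ≤ q := by exact_mod_cast (by omega)
  · have hq : 0 < q := Nat.pos_of_neZero q
    rw [← sum_Ico_consecutive _ (Nat.le_add_right k q) (not_lt.1 h),
      sum_Ico_add_character_eq_zero hχ, zero_add]
    exact norm_sum_Ico_character_le hχ (k + q) l
termination_by l - k

/-- The partial sums of `∑ χ(n)/n` approach `L(1, χ)` at rate `O(1/N)`. The estimate is uniform for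
`s > 1`, where the series converges absolutely, and passes to the limit `s → 1`. -/
theorem norm_LFunction_one_sub_sum_le {χ : DirichletCharacter ℂ q} (hχ : χ ≠ 1) (N : ℕ) :
    ‖χ.LFunction 1 - ∑ n ∈ Ico 1 (N + 1), χ n / n‖ ≤ q / (N + 1) := by
  have hs : ∀ s : ℝ, 1 < s →
      ‖χ.LFunction s - ∑ n ∈ Ico 1 (N + 1), χ n / (n : ℂ) ^ (s : ℂ)‖ ≤ q / (N + 1) := by
    intro s hs
    have hsum := (DirichletCharacter.LSeriesSummable_of_one_lt_re χ
      (s := s) (by simpa using hs)).hasSum.tendsto_sum_nat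
    change Tendsto _ _ (𝓝 (LSeries _ _)) at hsum
    rw [← DirichletCharacter.LFunction_eq_LSeries χ (by simpa using hs)] at hsum
    refine le_of_tendsto (hsum.sub_const _).norm ?_
    filter_upwards [eventually_ge_atTop (N + 1)] with M hM
    have e1 : ∀ a b : ℕ, 1 ≤ a → ∑ n ∈ Ico a b, LSeries.term (fun n => χ n) s n =
        ∑ n ∈ Ico a b, ((((n : ℝ) ^ s)⁻¹ : ℝ) : ℂ) * χ n := by
      intro a b ha
      refine sum_congr rfl fun n hn => ?_
      have : n ≠ 0 := by have := (mem_Ico.1 hn).1; omega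
      rw [LSeries.term_of_ne_zero this, Complex.ofReal_inv, Complex.ofReal_cpow (by positivity)]
      push_cast
      field_simp
    have e2 : ∑ n ∈ Ico 1 (N + 1), χ n / (n : ℂ) ^ (s : ℂ) =
        ∑ n ∈ Ico 1 (N + 1), LSeries.term (fun n => χ n) s n := by
      refine sum_congr rfl fun n hn => ?_
      have : n ≠ 0 := by have := (mem_Ico.1 hn).1; omega
      rw [LSeries.term_of_ne_zero this]
    rw [range_eq_Ico, sum_eq_sum_Ico_succ_bot (by omega), LSeries.term_zero, zero_add, e2,
      ← sum_Ico_consecutive _ (show 0 + 1 ≤ N + 1 by omega) hM, zero_add, add_sub_cancel_left,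
      e1 _ _ (by omega)]
    refine (norm_sum_Ico_mul_le hM (norm_sum_Ico_character_le hχ) ?_ ?_).trans ?_
    · intro k hk
      have : (0 : ℝ) < k := by exact_mod_cast (by omega)
      push_cast
      gcongr
      linarith
    · intro k _
      positivity
    · rw [div_eq_mul_inv]
      gcongr
      push_cast
      nth_rewrite 1 [← Real.rpow_one ((N : ℝ) + 1)]
      exact Real.rpow_le_rpow_of_exponent_le (by linarith [Nat.cast_nonneg (α := ℝ) N]) hs.le
  have hcont : Tendsto (fun s : ℝ => ‖χ.LFunction s - ∑ n ∈ Ico 1 (N + 1), χ n / (n : ℂ) ^ (s : ℂ)‖)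
      (𝓝[>] 1) (𝓝 ‖χ.LFunction 1 - ∑ n ∈ Ico 1 (N + 1), χ n / n‖) := by
    have hL : Continuous fun s : ℝ => χ.LFunction s :=
      (DirichletCharacter.differentiable_LFunction hχ).continuous.comp Complex.continuous_ofReal
    have h2 : ContinuousAt (fun s : ℝ => ∑ n ∈ Ico 1 (N + 1), χ n / (n : ℂ) ^ (s : ℂ)) 1 := by
      refine tendsto_finsetSum _ fun n hn => ?_
      have : (n : ℂ) ≠ 0 := by
        have := (mem_Ico.1 hn).1
        exact_mod_cast (by omega)
      refine Tendsto.div tendsto_const_nhds ?_ (by simp [this])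
      exact (Complex.continuous_ofReal.const_cpow (Or.inl this)).continuousAt
    have := ((hL.continuousAt (x := 1)).sub h2).norm.tendsto.mono_left
      (nhdsWithin_le_nhds (s := Set.Ioi 1))
    simpa using this
  refine le_of_tendsto hcont ?_
  filter_upwards [self_mem_nhdsWithin] with s h using hs s h

/-! ### Mertens' first theorem in residue classes -/

open ArithmeticFunction in
/-- For nontrivial `χ` the sums `∑ χ(n) Λ(n) / n` stay bounded. Multiplying by `L(1, χ) ≠ 0` and
replacing it by the partial sums over `m ≤ N / d` turns the sum into `∑ χ(n) log n / n`, which is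
bounded by Abel's inequality; Chebyshev's bound controls the error. -/
theorem exists_norm_sum_character_mul_vonMangoldt_div_le {q : ℕ} [NeZero q]
    {χ : DirichletCharacter ℂ q} (hχ : χ ≠ 1) :
    ∃ K : ℝ, ∀ N : ℕ, ‖∑ n ∈ Ioc 0 N, χ n * Λ n / n‖ ≤ K := by
  let F : ArithmeticFunction ℂ := ⟨fun n => χ n * Λ n / n, by simp⟩
  let G : ArithmeticFunction ℂ := ⟨fun n => χ n / n, by simp⟩
  have hF : ∀ n, F n = χ n * Λ n / n := fun _ => rfl
  have hG : ∀ n, G n = χ n / n := fun _ => rfl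
  have hFG : ∀ n, (F * G) n = χ n * Real.log n / n := by
    intro n
    rw [ArithmeticFunction.mul_apply, ← vonMangoldt_sum,
      ← Nat.sum_divisorsAntidiagonal (fun i _ => Λ i), Complex.ofReal_sum, mul_sum, sum_div]
    refine sum_congr rfl fun d hd => ?_
    rw [hF, hG, ← (Nat.mem_divisorsAntidiagonal.1 hd).1]
    push_cast
    rw [map_mul]
    ring
  set L := χ.LFunction 1 with hL
  have hL0 : L ≠ 0 := DirichletCharacter.LFunction_apply_one_ne_zero hχ
  have hlog : ∀ N : ℕ, ‖∑ n ∈ Ioc 0 N, χ n * Real.log n / n‖ ≤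
      ∑ n ∈ Ico (1 : ℕ) 3, ‖χ n * (Real.log n : ℂ) / n‖ + q * (Real.log 3 / 3) := by
    intro N
    have hpos : 0 ≤ (q : ℝ) * (Real.log 3 / 3) := by
      have := Real.log_nonneg (show (1 : ℝ) ≤ 3 by norm_num)
      positivity
    have hIoc : Ioc 0 N = Ico 1 (N + 1) := by ext; simp; omega
    rw [hIoc]
    rcases le_or_gt 3 (N + 1) with h | h
    · -- `log t / t` decreases only from `t = e` on, so the terms `n < 3` are split off
      rw [← sum_Ico_consecutive _ (show 1 ≤ 3 by norm_num) h]
      refine (norm_add_le _ _).trans (add_le_add (norm_sum_le _ _) ?_)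
      have e : ∀ n ∈ Ico 3 (N + 1), χ n * Real.log n / n =
          ((Real.log n / n : ℝ) : ℂ) * χ n := by
        intro n _
        push_cast
        ring
      rw [sum_congr rfl e]
      refine (norm_sum_Ico_mul_le h (norm_sum_Ico_character_le hχ) ?_ ?_).trans (by simp)
      · intro k hk
        have h3 : (3 : ℝ) ≤ k := by exact_mod_cast hk
        have he : Real.exp 1 ≤ 3 := by linarith [Real.exp_one_lt_d9]
        refine Real.log_div_self_antitoneOn ?_ ?_ ?_
        · exact he.trans h3
        · rw [Set.mem_Ici]; push_cast; linarith
        · push_cast; linarith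
      · intro k _
        exact div_nonneg (Real.log_natCast_nonneg k) (Nat.cast_nonneg k)
    · refine (norm_sum_le _ _).trans (le_trans ?_ (le_add_of_nonneg_right hpos))
      exact sum_le_sum_of_subset_of_nonneg (Ico_subset_Ico_right h.le) fun _ _ _ => norm_nonneg _
  refine ⟨(∑ n ∈ Ico (1 : ℕ) 3, ‖χ n * (Real.log n : ℂ) / n‖ + q * (Real.log 3 / 3) +
    q * (Real.log 4 + 4)) / ‖L‖, fun N => ?_⟩
  rw [le_div_iff₀ (norm_pos_iff.2 hL0), ← norm_mul]
  have hsplit : (∑ n ∈ Ioc 0 N, χ n * Λ n / n) * L = ∑ n ∈ Ioc 0 N, χ n * Real.log n / n +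
      ∑ d ∈ Ioc 0 N, F d * (L - ∑ m ∈ Ioc 0 (N / d), G m) := by
    rw [← sum_congr rfl fun n _ => hFG n, ArithmeticFunction.sum_Ioc_mul_eq_sum_sum,
      ← sum_add_distrib, sum_mul]
    refine sum_congr rfl fun d _ => ?_
    rw [hF]
    ring
  rw [hsplit]
  refine (norm_add_le _ _).trans (add_le_add (hlog N) ?_)
  refine (norm_sum_le _ _).trans ?_
  rcases Nat.eq_zero_or_pos N with rfl | hN
  · have := Real.log_nonneg (show (1 : ℝ) ≤ 4 by norm_num)
    simp
    positivity
  have hN' : (0 : ℝ) < N := by exact_mod_cast hN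
  calc ∑ d ∈ Ioc 0 N, ‖F d * (L - ∑ m ∈ Ioc 0 (N / d), G m)‖
      ≤ ∑ d ∈ Ioc 0 N, Λ d * (q / N) := by
        refine sum_le_sum fun d hd => ?_
        have hd' : (0 : ℝ) < d := by exact_mod_cast (mem_Ioc.1 hd).1
        have hIoc : Ioc 0 (N / d) = Ico 1 (N / d + 1) := by ext; simp; omega
        have h1 : ‖L - ∑ m ∈ Ioc 0 (N / d), G m‖ ≤ q / ((N / d : ℕ) + 1) := by
          rw [hIoc]
          exact norm_LFunction_one_sub_sum_le hχ (N / d)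
        have h2 : ‖F d‖ ≤ Λ d / d := by
          rw [hF, norm_div, norm_mul, Complex.norm_real, Complex.norm_natCast,
            Real.norm_of_nonneg vonMangoldt_nonneg]
          gcongr
          exact mul_le_of_le_one_left vonMangoldt_nonneg (χ.norm_le_one _)
        have h3 : (N : ℝ) ≤ d * ((N / d : ℕ) + 1) := by
          have := Nat.lt_mul_div_succ N (mem_Ioc.1 hd).1
          exact_mod_cast this.le
        rw [norm_mul]
        calc _ ≤ Λ d / d * (q / ((N / d : ℕ) + 1)) := by
              gcongr
          _ = Λ d * (q / (d * ((N / d : ℕ) + 1))) := by field_simp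
          _ ≤ Λ d * (q / N) := by
              gcongr
    _ = Chebyshev.psi N * (q / N) := by
        rw [← sum_mul, Chebyshev.psi, Nat.floor_natCast]
    _ ≤ (Real.log 4 + 4) * N * (q / N) := by
        gcongr
        exact Chebyshev.psi_le_const_mul_self hN'.le
    _ = q * (Real.log 4 + 4) := by field_simp

open ArithmeticFunction in
/-- **Mertens' first theorem** for the von Mangoldt function, by comparison with `log N!`. -/
theorem exists_abs_sum_vonMangoldt_div_sub_log_le :
    ∃ K : ℝ, ∀ N : ℕ, 1 ≤ N → |∑ n ∈ Ioc 0 N, Λ n / n - Real.log N| ≤ K := by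
  refine ⟨Real.log 4 + 4, fun N hN => ?_⟩
  have hN' : (0 : ℝ) < N := by exact_mod_cast hN
  have hfac : ∑ d ∈ Ioc 0 N, Λ d * ((N / d : ℕ) : ℝ) = Real.log N.factorial := by
    rw [← ArithmeticFunction.sum_Ioc_mul_zeta_eq_sum, vonMangoldt_mul_zeta,
      ← prod_Ico_id_eq_factorial, Nat.cast_prod, Real.log_prod]
    · refine sum_congr (by ext; simp; omega) fun _ _ => rfl
    · intro i hi
      have := (mem_Ico.1 hi).1
      exact_mod_cast (by omega)
  have hup : Real.log N.factorial ≤ N * Real.log N := by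
    rw [← Real.log_pow]
    refine Real.log_le_log (by exact_mod_cast N.factorial_pos) ?_
    exact_mod_cast N.factorial_le_pow
  have hlo : N * Real.log N - N ≤ Real.log N.factorial := by
    have h := Real.pow_div_factorial_le_exp (N : ℝ) hN'.le N
    have hf : (0 : ℝ) < N.factorial := by exact_mod_cast N.factorial_pos
    have := Real.log_le_log (by positivity) h
    rw [Real.log_exp, Real.log_div (by positivity) hf.ne', Real.log_pow] at this
    linarith
  have h1 : ∑ d ∈ Ioc 0 N, Λ d * ((N / d : ℕ) : ℝ) ≤ N * ∑ n ∈ Ioc 0 N, Λ n / n := by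
    rw [mul_sum]
    refine sum_le_sum fun d _ => ?_
    calc _ ≤ Λ d * ((N : ℝ) / d) := by
          exact mul_le_mul_of_nonneg_left Nat.cast_div_le vonMangoldt_nonneg
      _ = _ := by ring
  have h2 : N * ∑ n ∈ Ioc 0 N, Λ n / n ≤
      ∑ d ∈ Ioc 0 N, Λ d * ((N / d : ℕ) : ℝ) + Chebyshev.psi N := by
    rw [Chebyshev.psi, Nat.floor_natCast, mul_sum, ← sum_add_distrib]
    refine sum_le_sum fun d hd => ?_
    have hd' : (0 : ℝ) < d := by exact_mod_cast (mem_Ioc.1 hd).1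
    have h3 : (N : ℝ) / d ≤ (N / d : ℕ) + 1 := by
      have := Nat.lt_mul_div_succ N (mem_Ioc.1 hd).1
      rw [div_le_iff₀' hd']
      exact_mod_cast this.le
    calc (N : ℝ) * (Λ d / d) = Λ d * ((N : ℝ) / d) := by ring
      _ ≤ Λ d * ((N / d : ℕ) + 1) := mul_le_mul_of_nonneg_left h3 vonMangoldt_nonneg
      _ = _ := by ring
  have h3 := Chebyshev.psi_le_const_mul_self hN'.le
  have h4 := Real.log_nonneg (show (1 : ℝ) ≤ 4 by norm_num)
  rw [abs_le]
  constructor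
  · have : N * Real.log N - N ≤ N * ∑ n ∈ Ioc 0 N, Λ n / n := by linarith
    have : Real.log N - 1 ≤ ∑ n ∈ Ioc 0 N, Λ n / n := by
      refine le_of_mul_le_mul_left ?_ hN'
      linarith
    linarith
  · refine le_of_mul_le_mul_left ?_ hN'
    linarith

open ArithmeticFunction in
theorem summable_residueClass_zero_div {q : ℕ} (hq : q.Prime) :
    Summable fun n : ℕ => vonMangoldt.residueClass (0 : ZMod q) n / n := by
  have h1 := vonMangoldt.summable_residueClass_non_primes_div (0 : ZMod q)
  have h2 : Summable fun n : ℕ => (if n.Prime then vonMangoldt.residueClass (0 : ZMod q) n else 0) / n := by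
    refine summable_of_ne_finset_zero (s := {q}) fun n hn => ?_
    rw [mem_singleton] at hn
    split_ifs with hp
    · have : (n : ZMod q) ≠ 0 := by
        rw [Ne, ZMod.natCast_eq_zero_iff, Nat.prime_dvd_prime_iff_eq hq hp]
        exact fun h => hn h.symm
      simp [vonMangoldt.residueClass, this]
    · simp
  refine (h1.add h2).congr fun n => ?_
  split_ifs <;> simp

open ArithmeticFunction in
/-- **Mertens' first theorem** in the residue class `1` modulo a prime `q`. -/
theorem exists_abs_sum_residueClass_div_sub_log_le {q : ℕ} (hq : q.Prime) :
    ∃ K : ℝ, ∀ N : ℕ, 1 ≤ N →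
      |∑ n ∈ Ioc 0 N, vonMangoldt.residueClass (1 : ZMod q) n / n - Real.log N / (q - 1)| ≤ K := by
  classical
  have : NeZero q := ⟨hq.ne_zero⟩
  have : Fact q.Prime := ⟨hq⟩
  have hq1 : (0 : ℝ) < q - 1 := by
    have : (1 : ℝ) < q := by exact_mod_cast hq.one_lt
    linarith
  have htriv : ∃ K : ℝ, ∀ N : ℕ, 1 ≤ N →
      ‖∑ n ∈ Ioc 0 N, (1 : DirichletCharacter ℂ q) n * Λ n / n - Real.log N‖ ≤ K := by
    obtain ⟨K, hK⟩ := exists_abs_sum_vonMangoldt_div_sub_log_le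
    refine ⟨K + ∑' n : ℕ, vonMangoldt.residueClass (0 : ZMod q) n / n, fun N hN => ?_⟩
    have e : ∑ n ∈ Ioc 0 N, (1 : DirichletCharacter ℂ q) n * Λ n / n - Real.log N =
        (((∑ n ∈ Ioc 0 N, Λ n / n - Real.log N) -
          ∑ n ∈ Ioc 0 N, vonMangoldt.residueClass (0 : ZMod q) n / n : ℝ) : ℂ) := by
      push_cast
      rw [sub_right_comm, ← sum_sub_distrib]
      congr 1
      refine sum_congr rfl fun n _ => ?_
      by_cases h : (n : ZMod q) = 0
      · simp [vonMangoldt.residueClass, h, MulChar.map_zero]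
      · simp [vonMangoldt.residueClass, h, MulChar.one_apply (isUnit_iff_ne_zero.2 h)]
    rw [e, Complex.norm_real, Real.norm_eq_abs]
    refine (abs_sub _ _).trans (add_le_add (hK N hN) ?_)
    have h0 : ∀ n : ℕ, 0 ≤ vonMangoldt.residueClass (0 : ZMod q) n / n := fun n =>
      div_nonneg (vonMangoldt.residueClass_nonneg _ n) (Nat.cast_nonneg n)
    rw [abs_of_nonneg (sum_nonneg fun n _ => h0 n)]
    exact (summable_residueClass_zero_div hq).sum_le_tsum _ fun n _ => h0 n
  have hall : ∀ χ : DirichletCharacter ℂ q, ∃ K : ℝ, ∀ N : ℕ, 1 ≤ N →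
      ‖∑ n ∈ Ioc 0 N, χ n * Λ n / n - if χ = 1 then (Real.log N : ℂ) else 0‖ ≤ K := by
    intro χ
    by_cases h : χ = 1
    · simpa [h] using htriv
    · obtain ⟨K, hK⟩ := exists_norm_sum_character_mul_vonMangoldt_div_le h
      exact ⟨K, fun N _ => by simpa [h] using hK N⟩
  choose K hK using hall
  refine ⟨(∑ χ : DirichletCharacter ℂ q, K χ) / (q - 1), fun N hN => ?_⟩
  have hφ : (q.totient : ℂ) = ((q - 1 : ℝ) : ℂ) := by
    rw [Nat.totient_prime hq, Nat.cast_sub hq.one_le]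
    push_cast
    rfl
  have key : ((∑ n ∈ Ioc 0 N, vonMangoldt.residueClass (1 : ZMod q) n / n -
      Real.log N / (q - 1) : ℝ) : ℂ) =
      (∑ χ : DirichletCharacter ℂ q,
        (∑ n ∈ Ioc 0 N, χ n * Λ n / n - if χ = 1 then (Real.log N : ℂ) else 0)) /
        ((q - 1 : ℝ) : ℂ) := by
    rw [sum_sub_distrib, sum_ite_eq' univ (1 : DirichletCharacter ℂ q), if_pos (mem_univ _),
      sum_comm, sub_div, sum_div]
    push_cast
    congr 1
    refine sum_congr rfl fun n _ => ?_
    rw [vonMangoldt.residueClass_apply isUnit_one, hφ]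
    simp only [inv_one, map_one, one_mul, ← sum_mul, ← sum_div]
    push_cast
    field_simp
  rw [← Real.norm_eq_abs, ← Complex.norm_real, key, norm_div, Complex.norm_real,
    Real.norm_of_nonneg hq1.le]
  gcongr
  exact (norm_sum_le _ _).trans (sum_le_sum fun χ _ => hK χ N hN)

/-! ### Mertens' second theorem in the residue class `1` -/

open MeasureTheory in
/-- Partial summation from `∑ a(n) log n = c log N + O(1)` to
`∑ a(n) = c log log x + M + O(1 / log x)`. -/
theorem exists_abs_sum_sub_log_log_le {a : ℕ → ℝ} (ha0 : a 0 = 0) (ha1 : a 1 = 0) {c K : ℝ}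
    (hK : ∀ N : ℕ, 1 ≤ N → |∑ n ∈ Icc 0 N, a n * Real.log n - c * Real.log N| ≤ K) :
    ∃ M K' : ℝ, ∀ x : ℝ, 2 ≤ x →
      |∑ n ∈ Icc 0 ⌊x⌋₊, a n - c * Real.log (Real.log x) - M| ≤ K' / Real.log x := by
  set S : ℝ → ℝ := fun t => ∑ n ∈ Icc 0 ⌊t⌋₊, a n * Real.log n with hS
  set R : ℝ → ℝ := fun t => S t - c * Real.log t with hR
  set w : ℝ → ℝ := fun t => t⁻¹ / Real.log t ^ 2 with hw
  set B : ℝ := K + |c| * Real.log 2 with hB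
  have hRB : ∀ t : ℝ, 1 ≤ t → |R t| ≤ B := by
    intro t ht
    have hfl : 1 ≤ ⌊t⌋₊ := Nat.le_floor (by simpa using ht)
    have hfl' : (1 : ℝ) ≤ ⌊t⌋₊ := by exact_mod_cast hfl
    have h1 : R t = (S t - c * Real.log ⌊t⌋₊) - c * (Real.log t - Real.log ⌊t⌋₊) := by
      simp only [hR]; ring
    rw [h1]
    refine (abs_sub _ _).trans (add_le_add (hK _ hfl) ?_)
    rw [abs_mul]
    refine mul_le_mul_of_nonneg_left ?_ (abs_nonneg c)
    rw [← Real.log_div (by positivity) (by positivity), abs_of_nonneg]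
    · refine Real.log_le_log (by positivity) ?_
      rw [div_le_iff₀ (by positivity)]
      linarith [Nat.lt_floor_add_one t]
    · refine Real.log_nonneg ?_
      rw [one_le_div (by positivity)]
      exact Nat.floor_le (by positivity)
  have hlogpos : ∀ t : ℝ, 2 ≤ t → 0 < Real.log t := fun t ht => Real.log_pos (by linarith)
  have hw0 : ∀ t : ℝ, 2 ≤ t → 0 ≤ w t := fun t ht => by
    have : 0 < t := by linarith
    simp only [hw]
    positivity
  have hderiv : ∀ t : ℝ, 2 ≤ t → HasDerivAt (fun t => (Real.log t)⁻¹) (-w t) t := by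
    intro t ht
    have := (Real.hasDerivAt_log (show t ≠ 0 by linarith)).inv (hlogpos t ht).ne'
    rw [← neg_div]
    exact this
  have hderiv' : ∀ t : ℝ, 2 ≤ t → HasDerivAt (fun t => -(Real.log t)⁻¹) (w t) t := fun t ht =>
    neg_neg (w t) ▸ (hderiv t ht).fun_neg
  have hlim : Tendsto (fun t => -(Real.log t)⁻¹) atTop (𝓝 0) := by
    simpa using Real.tendsto_log_atTop.inv_tendsto_atTop.neg
  have hwint : ∀ x : ℝ, 2 ≤ x → IntegrableOn w (Set.Ioi x) := fun x hx =>
    integrableOn_Ioi_deriv_of_nonneg' (g := fun t => -(Real.log t)⁻¹)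
      (fun t ht => hderiv' t (hx.trans ht))
      (fun t ht => hw0 t (hx.trans (Set.mem_Ioi.1 ht).le)) hlim
  have hwval : ∀ x : ℝ, 2 ≤ x → ∫ t in Set.Ioi x, w t = (Real.log x)⁻¹ := fun x hx => by
    rw [integral_Ioi_of_hasDerivAt_of_nonneg' (g := fun t => -(Real.log t)⁻¹)
      (fun t ht => hderiv' t (hx.trans ht))
      (fun t ht => hw0 t (hx.trans (Set.mem_Ioi.1 ht).le)) hlim]
    simp
  have hSm : Measurable S :=
    (measurable_from_nat (f := fun N : ℕ => ∑ n ∈ Icc 0 N, a n * Real.log n)).comp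
      Nat.measurable_floor
  have hRm : Measurable R := hSm.sub (Real.measurable_log.const_mul c)
  have hwm : Measurable w := measurable_inv.div (Real.measurable_log.pow_const 2)
  have hwRbound : ∀ x : ℝ, 2 ≤ x → ∀ᵐ t ∂volume.restrict (Set.Ioi x), ‖w t * R t‖ ≤ B * w t := by
    intro x hx
    refine (ae_restrict_iff' measurableSet_Ioi).2 (Eventually.of_forall fun t ht => ?_)
    have h2 : 2 ≤ t := hx.trans (Set.mem_Ioi.1 ht).le
    rw [norm_mul, Real.norm_of_nonneg (hw0 t h2), Real.norm_eq_abs, mul_comm]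
    exact mul_le_mul_of_nonneg_right (hRB t (by linarith)) (hw0 t h2)
  have hwR : ∀ x : ℝ, 2 ≤ x → IntegrableOn (fun t => w t * R t) (Set.Ioi x) := fun x hx =>
    Integrable.mono' ((hwint x hx).const_mul B) (hwm.mul hRm).aestronglyMeasurable
      (hwRbound x hx)
  refine ⟨c - c * Real.log (Real.log 2) + ∫ t in Set.Ioi 2, w t * R t, 2 * B, fun x hx => ?_⟩
  have hcont : ContinuousOn (fun t => t⁻¹ / Real.log t) (Set.Icc 2 x) := by
    refine ContinuousOn.div ?_ ?_ ?_
    · exact continuousOn_inv₀.mono fun t ht => by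
        have := ht.1
        simp only [Set.mem_compl_iff, Set.mem_singleton_iff]
        linarith
    · exact Real.continuousOn_log.mono fun t ht => by
        have := ht.1
        simp only [Set.mem_compl_iff, Set.mem_singleton_iff]
        linarith
    · exact fun t ht => (hlogpos t ht.1).ne'
  have hll : ∫ t in Set.Ioc 2 x, t⁻¹ / Real.log t =
      Real.log (Real.log x) - Real.log (Real.log 2) := by
    rw [← intervalIntegral.integral_of_le hx]
    refine intervalIntegral.integral_eq_sub_of_hasDerivAt (f := fun t => Real.log (Real.log t))
      (fun t ht => ?_) ?_
    · rw [Set.uIcc_of_le hx] at ht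
      exact (Real.hasDerivAt_log (by linarith [ht.1])).log (hlogpos t ht.1).ne'
    · refine ContinuousOn.intervalIntegrable ?_
      rwa [Set.uIcc_of_le hx]
  have habel : ∑ n ∈ Icc 0 ⌊x⌋₊, a n =
      (Real.log x)⁻¹ * S x + ∫ t in Set.Ioc 2 x, w t * S t := by
    have h := sum_mul_eq_sub_integral_mul₁ (f := fun t : ℝ => (Real.log t)⁻¹)
      (fun n => a n * Real.log n) (by simp [ha0]) (by simp [ha1]) x
      (fun t ht => (hderiv t ht.1).differentiableAt) ?_
    · have e1 : ∑ n ∈ Icc 0 ⌊x⌋₊, (Real.log n)⁻¹ * (a n * Real.log n) =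
          ∑ n ∈ Icc 0 ⌊x⌋₊, a n := by
        refine sum_congr rfl fun n _ => ?_
        rcases Nat.lt_or_ge n 2 with h | h
        · interval_cases n <;> simp [ha0, ha1]
        · have := (hlogpos n (by exact_mod_cast h)).ne'
          field_simp
      rw [← e1, h, sub_eq_add_neg, ← integral_neg]
      congr 1
      refine setIntegral_congr_fun measurableSet_Ioc fun t ht => ?_
      simp only [(hderiv t ht.1.le).deriv, neg_mul, neg_neg, hS]
    · have : IntegrableOn (fun t => -w t) (Set.Icc 2 x) := by
        rw [integrableOn_Icc_iff_integrableOn_Ioc]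
        exact ((hwint 2 le_rfl).mono_set Set.Ioc_subset_Ioi_self).neg
      exact this.congr_fun (fun t ht => (hderiv t ht.1).deriv.symm) measurableSet_Icc
  have hsplit : ∫ t in Set.Ioc 2 x, w t * S t =
      (∫ t in Set.Ioc 2 x, w t * R t) + c * (Real.log (Real.log x) - Real.log (Real.log 2)) := by
    rw [← hll, ← integral_const_mul, ← integral_add]
    · refine setIntegral_congr_fun measurableSet_Ioc fun t ht => ?_
      have := (hlogpos t ht.1.le).ne'
      simp only [hR, hw]
      field_simp
      ring
    · exact (hwR 2 le_rfl).mono_set Set.Ioc_subset_Ioi_self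
    · exact ((hcont.integrableOn_Icc).mono_set Set.Ioc_subset_Icc_self).const_mul c
  have htail : ∫ t in Set.Ioi 2, w t * R t =
      (∫ t in Set.Ioc 2 x, w t * R t) + ∫ t in Set.Ioi x, w t * R t := by
    rw [← setIntegral_union Set.Ioc_disjoint_Ioi_same measurableSet_Ioi
      ((hwR 2 le_rfl).mono_set Set.Ioc_subset_Ioi_self) (hwR x hx), Set.Ioc_union_Ioi_eq_Ioi hx]
  have hlx := hlogpos x hx
  have htailB : |∫ t in Set.Ioi x, w t * R t| ≤ B / Real.log x := by
    refine (norm_integral_le_of_norm_le ((hwint x hx).const_mul B) (hwRbound x hx)).trans ?_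
    rw [integral_const_mul, hwval x hx, div_eq_mul_inv]
  have hfin : ∑ n ∈ Icc 0 ⌊x⌋₊, a n - c * Real.log (Real.log x) -
      (c - c * Real.log (Real.log 2) + ∫ t in Set.Ioi 2, w t * R t) =
      R x / Real.log x - ∫ t in Set.Ioi x, w t * R t := by
    rw [habel, hsplit, htail]
    simp only [hR]
    field_simp
    ring
  rw [hfin]
  refine (abs_sub _ _).trans ?_
  rw [abs_div, abs_of_pos hlx, two_mul, add_div]
  gcongr
  exact hRB x (by linarith)

/-- The function `-log (1 - 1/n)` restricted to the primes congruent to `1` modulo `q`. -/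
noncomputable def primeWeight (q n : ℕ) : ℝ :=
  if n.Prime ∧ n ≡ 1 [MOD q] then -Real.log (1 - 1 / (n : ℝ)) else 0

theorem abs_neg_log_one_sub_sub_le {y : ℝ} (hy0 : 0 ≤ y) (hy : y ≤ 1 / 2) :
    |-Real.log (1 - y) - y| ≤ 2 * y ^ 2 := by
  have h := Real.abs_log_sub_add_sum_range_le (x := y) (by rw [abs_of_nonneg hy0]; linarith) 1
  rw [abs_of_nonneg hy0] at h
  have e : |-Real.log (1 - y) - y| = |∑ i ∈ range 1, y ^ (i + 1) / ((i : ℝ) + 1) +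
      Real.log (1 - y)| := by
    rw [← abs_neg]
    congr 1
    simp
  rw [e]
  refine h.trans ?_
  rw [div_le_iff₀ (by linarith)]
  change y ^ 2 ≤ _
  nlinarith [mul_nonneg (sq_nonneg y) (sub_nonneg.2 hy)]

open ArithmeticFunction in
/-- Replacing `Λ(n) / n` by the prime weights changes the sums of Mertens' first theorem by a
convergent series: the proper prime powers and the terms `O(log p / p²)`. -/
theorem exists_abs_sum_primeWeight_mul_log_le {q : ℕ} (hq : q.Prime) :
    ∃ K : ℝ, ∀ N : ℕ, 1 ≤ N →
      |∑ n ∈ Icc 0 N, primeWeight q n * Real.log n - 1 / ((q : ℝ) - 1) * Real.log N| ≤ K := by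
  have hnz : NeZero q := ⟨hq.ne_zero⟩
  obtain ⟨K, hK⟩ := exists_abs_sum_residueClass_div_sub_log_le hq
  set d : ℕ → ℝ := fun n => primeWeight q n * Real.log n -
    vonMangoldt.residueClass (1 : ZMod q) n / n with hd
  have hsum : Summable fun n => |d n| := by
    have h1 := vonMangoldt.summable_residueClass_non_primes_div (1 : ZMod q)
    have h2 : Summable fun n : ℕ => 4 * (n : ℝ) ^ (-(3 / 2) : ℝ) :=
      (Real.summable_nat_rpow.2 (by norm_num)).mul_left 4
    refine Summable.of_nonneg_of_le (fun _ => abs_nonneg _) (fun n => ?_) (h1.add h2)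
    have hr0 : 0 ≤ 4 * (n : ℝ) ^ (-(3 / 2) : ℝ) := by positivity
    have hres : 0 ≤ vonMangoldt.residueClass (1 : ZMod q) n / n :=
      div_nonneg (vonMangoldt.residueClass_nonneg _ n) (Nat.cast_nonneg n)
    by_cases hp : n.Prime
    · simp only [hp, if_true, zero_div, zero_add]
      by_cases h1 : n ≡ 1 [MOD q]
      · have h1' : (n : ZMod q) = 1 := by simpa using (ZMod.natCast_eq_natCast_iff n 1 q).2 h1
        have hn2 : (2 : ℝ) ≤ n := by exact_mod_cast hp.two_le
        have hn0 : (0 : ℝ) < n := by linarith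
        have e : d n = (-Real.log (1 - 1 / (n : ℝ)) - 1 / n) * Real.log n := by
          simp only [hd, primeWeight, hp, h1, and_self, if_true, vonMangoldt.residueClass,
            Set.indicator_apply, Set.mem_ofPred_eq, h1', vonMangoldt_apply_prime]
          ring
        rw [e, abs_mul, abs_of_nonneg (Real.log_natCast_nonneg n)]
        have hy := abs_neg_log_one_sub_sub_le (y := 1 / (n : ℝ)) (by positivity)
          (one_div_le_one_div_of_le (by norm_num) hn2)
        have hl := Real.log_le_rpow_div hn0.le (show (0 : ℝ) < 1 / 2 by norm_num)
        calc _ ≤ (2 * (1 / (n : ℝ)) ^ 2) * ((n : ℝ) ^ (1 / 2 : ℝ) / (1 / 2)) :=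
              mul_le_mul hy hl (Real.log_natCast_nonneg n) (by positivity)
          _ = 4 * ((n : ℝ) ^ (1 / 2 : ℝ) / (n : ℝ) ^ (2 : ℝ)) := by
              rw [Real.rpow_two]
              field_simp
              norm_num
          _ = 4 * (n : ℝ) ^ (-(3 / 2) : ℝ) := by
              rw [← Real.rpow_sub hn0]
              norm_num
      · have h1' : (n : ZMod q) ≠ 1 := fun h =>
          h1 ((ZMod.natCast_eq_natCast_iff n 1 q).1 (by simpa using h))
        simpa [hd, primeWeight, h1, vonMangoldt.residueClass, h1'] using hr0
    · simp only [hd, primeWeight, hp, false_and, if_false, zero_mul, zero_sub, abs_neg,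
        abs_of_nonneg hres]
      linarith
  refine ⟨K + ∑' n, |d n|, fun N hN => ?_⟩
  have hI : ∑ n ∈ Icc 0 N, primeWeight q n * Real.log n =
      ∑ n ∈ Ioc 0 N, vonMangoldt.residueClass (1 : ZMod q) n / n + ∑ n ∈ Ioc 0 N, d n := by
    rw [← sum_add_distrib, ← add_sum_Ioc_eq_sum_Icc (Nat.zero_le N)]
    simp [hd]
  have e : ∑ n ∈ Icc 0 N, primeWeight q n * Real.log n - 1 / ((q : ℝ) - 1) * Real.log N =
      (∑ n ∈ Ioc 0 N, vonMangoldt.residueClass (1 : ZMod q) n / n - Real.log N / (q - 1)) +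
        ∑ n ∈ Ioc 0 N, d n := by
    rw [hI]
    ring
  rw [e]
  refine (abs_add_le _ _).trans (add_le_add (hK N hN) ?_)
  exact (abs_sum_le_sum_abs _ _).trans (hsum.sum_le_tsum _ fun _ _ => abs_nonneg _)

/-- **Mertens' second theorem** for the primes congruent to `1` modulo `q`. -/
theorem exists_abs_sum_primeWeight_sub_le {q : ℕ} (hq : q.Prime) :
    ∃ M K : ℝ, ∀ x : ℝ, 2 ≤ x →
      |∑ n ∈ Icc 0 ⌊x⌋₊, primeWeight q n - 1 / ((q : ℝ) - 1) * Real.log (Real.log x) - M| ≤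
        K / Real.log x := by
  obtain ⟨K, hK⟩ := exists_abs_sum_primeWeight_mul_log_le hq
  exact exists_abs_sum_sub_log_log_le (by simp [primeWeight]) (by simp [primeWeight]) hK

/-! ### From Mertens' theorem to the behaviour of the Dirichlet series at `s = 1` -/

theorem tendsto_log_one_sub_exp_neg_sub_log :
    Tendsto (fun δ : ℝ => Real.log (1 - Real.exp (-δ)) - Real.log δ) (𝓝[>] 0) (𝓝 0) := by
  have hd : HasDerivAt (fun δ : ℝ => 1 - Real.exp (-δ)) 1 0 := by
    have := ((hasDerivAt_neg (0 : ℝ)).exp).const_sub 1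
    simpa using this
  have h1 := hd.tendsto_slope.mono_left (nhdsWithin_mono 0 (fun x hx => (ne_of_gt hx : x ≠ 0) :
    Set.Ioi (0 : ℝ) ⊆ {0}ᶜ))
  have h2 := (Real.continuousAt_log one_ne_zero).tendsto.comp h1
  rw [Real.log_one] at h2
  refine h2.congr' ?_
  filter_upwards [self_mem_nhdsWithin] with δ hδ
  have hδ' : 0 < δ := hδ
  have : 0 < 1 - Real.exp (-δ) := by
    rw [sub_pos, Real.exp_lt_one_iff]
    linarith
  rw [← Real.log_div this.ne' hδ'.ne']
  simp [slope_def_field]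

theorem tendsto_exp_sub_one_mul_log :
    Tendsto (fun δ : ℝ => (Real.exp δ - 1) * Real.log (1 / δ)) (𝓝[>] 0) (𝓝 0) := by
  have hd : HasDerivAt Real.exp 1 0 := by simpa using Real.hasDerivAt_exp 0
  have h1 := hd.tendsto_slope.mono_left (nhdsWithin_mono 0 (fun x hx => (ne_of_gt hx : x ≠ 0) :
    Set.Ioi (0 : ℝ) ⊆ {0}ᶜ))
  have h2 : Tendsto (fun δ : ℝ => -(Real.log δ * δ)) (𝓝[>] 0) (𝓝 0) := by
    have := (Real.continuous_mul_log.tendsto 0).neg.mono_left (nhdsWithin_le_nhds (s := Set.Ioi 0))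
    simpa [mul_comm] using this
  have := h1.mul h2
  rw [mul_zero] at this
  refine this.congr' ?_
  filter_upwards [self_mem_nhdsWithin] with δ hδ
  have hδ' : δ ≠ 0 := ne_of_gt hδ
  simp only [slope_def_field, sub_zero, Real.exp_zero, one_div, Real.log_inv]
  field_simp

/-- An Abelian theorem. If `∑_{n ≤ x} a(n) - c log log x → M` with `a ≥ 0`, then
`∑ a(n) n ^ (-δ) - c log (1/δ) → M - c γ` as `δ → 0+`. Euler's constant enters as follows: grouping
the `n` with `⌈log n⌉ = k` gives a power series in `exp (-δ)` whose `m`-th partial sum is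
`c log m + M + o(1) = c H_m + (M - c γ) + o(1)`, and Abel's limit theorem applies to its difference
with `c ∑ z ^ k / k = -c log (1 - z)`. -/
theorem tendsto_tsum_mul_rpow_sub_log {a : ℕ → ℝ} (ha : ∀ n, 0 ≤ a n) (ha0 : a 0 = 0) {c M : ℝ}
    (hA : Tendsto (fun x : ℝ => ∑ n ∈ Icc 0 ⌊x⌋₊, a n - c * Real.log (Real.log x)) atTop (𝓝 M))
    (hs : ∀ δ : ℝ, 0 < δ → Summable fun n : ℕ => a n * (n : ℝ) ^ (-δ)) :
    Tendsto (fun δ : ℝ => ∑' n : ℕ, a n * (n : ℝ) ^ (-δ) - c * Real.log (1 / δ)) (𝓝[>] 0)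
      (𝓝 (M - c * Real.eulerMascheroniConstant)) := by
  set k : ℕ → ℕ := fun n => ⌈Real.log n⌉₊ with hk
  have hkle : ∀ n m : ℕ, k n ≤ m ↔ n ≤ ⌊Real.exp m⌋₊ := by
    intro n m
    rw [hk, Nat.ceil_le, Nat.le_floor_iff (Real.exp_pos _).le]
    rcases Nat.eq_zero_or_pos n with rfl | hn
    · simp [(Real.exp_pos _).le]
    · exact Real.log_le_iff_le_exp (by exact_mod_cast hn)
  set b : ℕ → ℝ := fun K => ∑ n ∈ Icc 0 ⌊Real.exp K⌋₊ with k n = K, a n with hb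
  have hpartial : ∀ m : ℕ, ∑ K ∈ range (m + 1), b K = ∑ n ∈ Icc 0 ⌊Real.exp m⌋₊, a n := by
    intro m
    refine Eq.trans ?_ (sum_fiberwise_of_maps_to (g := k) (t := range (m + 1)) ?_ a)
    · refine sum_congr rfl fun K hK => sum_congr ?_ fun _ _ => rfl
      ext n
      simp only [mem_filter, mem_Icc, Nat.zero_le, true_and, ← hkle]
      have := mem_range.1 hK
      omega
    · intro n hn
      rw [mem_range, Nat.lt_succ_iff, hkle]
      exact (mem_Icc.1 hn).2
  -- the two-sided comparison of `n ^ (-δ)` with the power of `exp (-δ)` that replaces it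
  have hlow : ∀ δ : ℝ, 0 < δ → ∀ n : ℕ,
      a n * Real.exp (-δ) ^ k n ≤ a n * (n : ℝ) ^ (-δ) := by
    intro δ hδ n
    rcases Nat.eq_zero_or_pos n with rfl | hn
    · simp [ha0]
    · refine mul_le_mul_of_nonneg_left ?_ (ha n)
      rw [← Real.exp_nat_mul, Real.rpow_def_of_pos (by exact_mod_cast hn)]
      refine Real.exp_le_exp.2 ?_
      nlinarith [Nat.le_ceil (Real.log n)]
  have hupp : ∀ δ : ℝ, 0 < δ → ∀ n : ℕ,
      a n * (n : ℝ) ^ (-δ) ≤ Real.exp δ * (a n * Real.exp (-δ) ^ k n) := by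
    intro δ hδ n
    rcases Nat.eq_zero_or_pos n with rfl | hn
    · simp [ha0]
    · rw [mul_left_comm]
      refine mul_le_mul_of_nonneg_left ?_ (ha n)
      rw [← Real.exp_nat_mul, Real.rpow_def_of_pos (by exact_mod_cast hn), ← Real.exp_add]
      refine Real.exp_le_exp.2 ?_
      nlinarith [Nat.ceil_lt_add_one (Real.log_natCast_nonneg n)]
  have hsz : ∀ δ : ℝ, 0 < δ → Summable fun n : ℕ => a n * Real.exp (-δ) ^ k n := fun δ hδ =>
    Summable.of_nonneg_of_le (fun n => mul_nonneg (ha n) (by positivity)) (hlow δ hδ) (hs δ hδ)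
  set X : ℝ → ℝ := fun δ => ∑' n : ℕ, a n * Real.exp (-δ) ^ k n with hX
  set Y : ℝ → ℝ := fun δ => ∑' n : ℕ, a n * (n : ℝ) ^ (-δ) with hY
  have hXY : ∀ δ : ℝ, 0 < δ → X δ ≤ Y δ := fun δ hδ =>
    (hsz δ hδ).tsum_le_tsum (hlow δ hδ) (hs δ hδ)
  have hYX : ∀ δ : ℝ, 0 < δ → Y δ ≤ Real.exp δ * X δ := fun δ hδ => by
    rw [hX, ← tsum_mul_left]
    exact (hs δ hδ).tsum_le_tsum (hupp δ hδ) ((hsz δ hδ).mul_left _)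
  have hXb : ∀ δ : ℝ, 0 < δ → HasSum (fun K => b K * Real.exp (-δ) ^ K) (X δ) := by
    intro δ hδ
    have h := (hsz δ hδ).hasSum.tsum_fiberwise k
    convert! h using 2 with K
    have hset : k ⁻¹' {K} = ((Icc 0 ⌊Real.exp K⌋₊).filter (k · = K) : Finset ℕ) := by
      ext n
      simp only [Set.mem_preimage, Set.mem_singleton_iff, coe_filter, mem_Icc, Nat.zero_le,
        true_and, ← hkle, Set.mem_ofPred_eq]
      omega
    rw [hset, Finset.tsum_subtype' _ (fun n => a n * Real.exp (-δ) ^ k n), hb, sum_mul]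
    refine sum_congr rfl fun n hn => ?_
    rw [(mem_filter.1 hn).2]
  set u : ℕ → ℝ := fun K => b K - c * (1 / (K : ℝ)) with hu
  have hupart : Tendsto (fun n => ∑ K ∈ range n, u K) atTop
      (𝓝 (M - c * Real.eulerMascheroniConstant)) := by
    rw [← tendsto_add_atTop_iff_nat 1]
    have h1 := hA.comp (Real.tendsto_exp_atTop.comp tendsto_natCast_atTop_atTop)
    have h2 := Real.tendsto_harmonic_sub_log.const_mul c
    refine (h1.sub h2).congr fun m => ?_
    have hH : ∑ K ∈ range (m + 1), (1 / (K : ℝ)) = (harmonic m : ℝ) := by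
      rw [sum_range_succ', harmonic]
      push_cast
      simp
    simp only [Function.comp_apply, Real.log_exp]
    rw [← hpartial, hu, sum_sub_distrib, ← mul_sum, hH]
    ring
  have hz : ∀ δ : ℝ, 0 < δ → HasSum (fun K : ℕ => 1 / (K : ℝ) * Real.exp (-δ) ^ K)
      (-Real.log (1 - Real.exp (-δ))) := by
    intro δ hδ
    have h := Real.hasSum_pow_div_log_of_abs_lt_one (x := Real.exp (-δ)) (by
      rw [abs_of_pos (Real.exp_pos _), Real.exp_lt_one_iff]
      linarith)
    rw [← hasSum_nat_add_iff' 1]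
    simp only [range_one, sum_singleton, Nat.cast_zero, div_zero, zero_mul, sub_zero]
    convert! h using 2 with n
    push_cast
    ring
  have hXu : ∀ δ : ℝ, 0 < δ →
      X δ = ∑' K, u K * Real.exp (-δ) ^ K - c * Real.log (1 - Real.exp (-δ)) := by
    intro δ hδ
    have h := (hXb δ hδ).sub ((hz δ hδ).mul_left c)
    have e : ∑' K, u K * Real.exp (-δ) ^ K = X δ - c * -Real.log (1 - Real.exp (-δ)) := by
      rw [← h.tsum_eq]
      refine tsum_congr fun K => ?_
      simp only [hu]
      ring
    rw [e]
    ring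
  have hexp : Tendsto (fun δ : ℝ => Real.exp (-δ)) (𝓝[>] 0) (𝓝[<] 1) := by
    refine tendsto_nhdsWithin_iff.2 ⟨?_, ?_⟩
    · have : Continuous fun δ : ℝ => Real.exp (-δ) := by fun_prop
      simpa using (this.tendsto 0).mono_left (nhdsWithin_le_nhds (s := Set.Ioi 0))
    · filter_upwards [self_mem_nhdsWithin] with δ hδ
      have : 0 < δ := hδ
      simpa using this
  have hXlim : Tendsto (fun δ => X δ - c * Real.log (1 / δ)) (𝓝[>] 0)
      (𝓝 (M - c * Real.eulerMascheroniConstant)) := by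
    have h1 := (Real.tendsto_tsum_powerSeries_nhdsWithin_lt hupart).comp hexp
    have h2 := tendsto_log_one_sub_exp_neg_sub_log.const_mul c
    have h3 := h1.sub h2
    rw [mul_zero, sub_zero] at h3
    refine h3.congr' ?_
    filter_upwards [self_mem_nhdsWithin] with δ hδ
    rw [hXu δ hδ, one_div, Real.log_inv]
    simp only [Function.comp_apply]
    ring
  have hup : Tendsto (fun δ => (X δ - c * Real.log (1 / δ)) + ((Real.exp δ - 1) *
      (X δ - c * Real.log (1 / δ)) + c * ((Real.exp δ - 1) * Real.log (1 / δ)))) (𝓝[>] 0)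
      (𝓝 (M - c * Real.eulerMascheroniConstant)) := by
    have h1 : Tendsto (fun δ : ℝ => Real.exp δ - 1) (𝓝[>] 0) (𝓝 0) := by
      have : Continuous fun δ : ℝ => Real.exp δ - 1 := by fun_prop
      simpa using (this.tendsto 0).mono_left (nhdsWithin_le_nhds (s := Set.Ioi 0))
    simpa using hXlim.add ((h1.mul hXlim).add (tendsto_exp_sub_one_mul_log.const_mul c))
  refine tendsto_of_tendsto_of_tendsto_of_le_of_le' hXlim hup ?_ ?_
  · filter_upwards [self_mem_nhdsWithin] with δ hδ
    have := hXY δ hδ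
    linarith
  · filter_upwards [self_mem_nhdsWithin] with δ hδ
    have := hYX δ hδ
    linarith

/-! ### The Euler product of a Dedekind zeta function -/

section DedekindZeta

open NumberField Ideal

variable (K : Type*) [Field K] [NumberField K]

theorem LSeriesSummable_card_absNorm {s : ℝ} (hs : 1 < s) :
    LSeriesSummable (fun n => ((Nat.card {I : Ideal (𝓞 K) // absNorm I = n} : ℝ) : ℂ)) s := by
  refine LSeriesSummable_of_sum_norm_bigO_and_nonneg (r := 1) ?_ (fun _ => Nat.cast_nonneg _)
    zero_le_one (by simpa using hs)
  have hb := ((Ideal.tendsto_norm_le_div_atTop K).comp tendsto_natCast_atTop_atTop).isBigO_one ℝ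
  have h2 : (fun n : ℕ => ∑ k ∈ Icc 1 n, (Nat.card {I : Ideal (𝓞 K) // absNorm I = k} : ℝ))
      =O[atTop] fun n : ℕ =>
        (Nat.card {I : Ideal (𝓞 K) // absNorm I ≤ n} : ℝ) / n * n := by
    refine Asymptotics.IsBigO.of_bound 1 ?_
    filter_upwards [eventually_ge_atTop 1] with n hn
    have hn' : (n : ℝ) ≠ 0 := by positivity
    rw [div_mul_cancel₀ _ hn', one_mul, Real.norm_of_nonneg (by positivity),
      Real.norm_of_nonneg (by positivity), ← Nat.cast_sum, Nat.cast_le]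
    have e := Finset.card_preimage_eq_sum_card_image_eq (f := fun I : Ideal (𝓞 K) => absNorm I)
      (s := Icc 0 n) (fun k _ => finite_setOfPred_absNorm_eq k)
    have e2 : Nat.card {I : Ideal (𝓞 K) // absNorm I ≤ n} =
        ∑ k ∈ Icc 0 n, Nat.card {I : Ideal (𝓞 K) // absNorm I = k} := by
      rw [← e]
      simp [Set.coe_eq_subtype]
    rw [e2]
    exact sum_le_sum_of_subset (Icc_subset_Icc_left zero_le_one)
  refine h2.trans ?_
  have h3 := hb.mul (Asymptotics.isBigO_refl (fun n : ℕ => (n : ℝ)) atTop)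
  simp only [Function.comp_def, one_mul, Nat.cast_le] at h3
  simpa using h3

theorem hasSum_fiber_absNorm_rpow (s : ℝ) (n : ℕ) :
    HasSum (fun I : {I : Ideal (𝓞 K) // absNorm I = n} => (absNorm I.1 : ℝ) ^ (-s))
      ((Nat.card {I : Ideal (𝓞 K) // absNorm I = n} : ℝ) * (n : ℝ) ^ (-s)) := by
  have : Finite {I : Ideal (𝓞 K) // absNorm I = n} := finite_setOfPred_absNorm_eq n
  have := Fintype.ofFinite {I : Ideal (𝓞 K) // absNorm I = n}
  convert! hasSum_fintype _
  rw [sum_congr rfl fun I _ => by rw [I.2], sum_const, card_univ, Nat.card_eq_fintype_card,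
    nsmul_eq_mul]

theorem term_card_absNorm {s : ℝ} (hs : 1 < s) (n : ℕ) :
    LSeries.term (fun n => ((Nat.card {I : Ideal (𝓞 K) // absNorm I = n} : ℝ) : ℂ)) s n =
      (((Nat.card {I : Ideal (𝓞 K) // absNorm I = n} : ℝ) * (n : ℝ) ^ (-s) : ℝ) : ℂ) := by
  rcases Nat.eq_zero_or_pos n with rfl | hn
  · rw [LSeries.term_zero, Nat.cast_zero, Real.zero_rpow (by linarith)]
    simp
  · rw [LSeries.term_of_ne_zero hn.ne', Real.rpow_neg (by positivity), Complex.ofReal_mul,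
      Complex.ofReal_inv, Complex.ofReal_cpow (by positivity), div_eq_mul_inv,
      Complex.ofReal_natCast n]

theorem summable_absNorm_rpow {s : ℝ} (hs : 1 < s) :
    Summable fun I : Ideal (𝓞 K) => (absNorm I : ℝ) ^ (-s) := by
  rw [← (Equiv.sigmaFiberEquiv fun I : Ideal (𝓞 K) => absNorm I).summable_iff,
    summable_sigma_of_nonneg]
  swap
  · exact fun _ => Real.rpow_nonneg (Nat.cast_nonneg _) _
  refine ⟨fun n => (hasSum_fiber_absNorm_rpow K s n).summable, ?_⟩
  have h := LSeriesSummable_card_absNorm K hs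
  rw [LSeriesSummable, funext (term_card_absNorm K hs), Complex.summable_ofReal] at h
  exact h.congr fun n => (hasSum_fiber_absNorm_rpow K s n).tsum_eq.symm

theorem dedekindZeta_eq_tsum_absNorm {s : ℝ} (hs : 1 < s) :
    dedekindZeta K s = ((∑' I : Ideal (𝓞 K), (absNorm I : ℝ) ^ (-s) : ℝ) : ℂ) := by
  have h := (Equiv.sigmaFiberEquiv fun I : Ideal (𝓞 K) => absNorm I).tsum_eq
    fun I => (absNorm I : ℝ) ^ (-s)
  have hsum := (Equiv.sigmaFiberEquiv fun I : Ideal (𝓞 K) => absNorm I).summable_iff.2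
    (summable_absNorm_rpow K hs)
  rw [← h]
  change _ = ((∑' c, ((fun I : Ideal (𝓞 K) => (absNorm I : ℝ) ^ (-s)) ∘
    (Equiv.sigmaFiberEquiv fun I : Ideal (𝓞 K) => absNorm I)) c : ℝ) : ℂ)
  rw [hsum.tsum_sigma, Complex.ofReal_tsum, dedekindZeta, LSeries]
  refine tsum_congr fun n => ?_
  exact (term_card_absNorm K hs n).trans
    (congrArg _ (hasSum_fiber_absNorm_rpow K s n).tsum_eq.symm)

open scoped Classical in
/-- The sum of `N(I) ^ (-s)` over the integral ideals `I` that are divisible by no member of `S`. -/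
noncomputable def sievedZeta (S : Finset (Ideal (𝓞 K))) (s : ℝ) : ℝ :=
  ∑' I : Ideal (𝓞 K), if ∀ P ∈ S, ¬ P ∣ I then (absNorm I : ℝ) ^ (-s) else 0

variable {K}

theorem summable_sieved {s : ℝ} (hs : 1 < s) (p : Ideal (𝓞 K) → Prop) [DecidablePred p] :
    Summable fun I : Ideal (𝓞 K) => if p I then (absNorm I : ℝ) ^ (-s) else 0 := by
  refine Summable.of_nonneg_of_le (fun I => ?_) (fun I => ?_) (summable_absNorm_rpow K hs)
  · split_ifs <;> positivity
  · split_ifs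
    · exact le_rfl
    · positivity

open scoped Classical in
/-- Sieving by one more prime `P` multiplies the sum by `1 - N(P) ^ (-s)`: the ideals removed are
the multiples of `P`. -/
theorem sievedZeta_insert {S : Finset (Ideal (𝓞 K))} (hS : ∀ Q ∈ S, Q.IsPrime ∧ Q ≠ ⊥)
    {P : Ideal (𝓞 K)} (hP : P.IsPrime) (hP0 : P ≠ ⊥) (hPS : P ∉ S) {s : ℝ} (hs : 1 < s) :
    sievedZeta K (insert P S) s = (1 - (absNorm P : ℝ) ^ (-s)) * sievedZeta K S s := by
  have hmul : ∀ J : Ideal (𝓞 K), (∀ Q ∈ S, ¬ Q ∣ P * J) ↔ ∀ Q ∈ S, ¬ Q ∣ J := by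
    intro J
    refine forall₂_congr fun Q hQ => not_congr ?_
    have hQp : Prime Q := prime_of_isPrime (hS Q hQ).2 (hS Q hQ).1
    refine ⟨fun h => (hQp.dvd_or_dvd h).resolve_left fun h' => hPS ?_, fun h => h.mul_left P⟩
    have hmax : P.IsMaximal := hP.isMaximal hP0
    rw [hmax.eq_of_le (hS Q hQ).1.ne_top (le_of_dvd h')]
    exact hQ
  have hremoved : ∑' I : Ideal (𝓞 K),
      (if P ∣ I ∧ ∀ Q ∈ S, ¬ Q ∣ I then (absNorm I : ℝ) ^ (-s) else 0) =
      (absNorm P : ℝ) ^ (-s) * sievedZeta K S s := by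
    have hinj : Function.Injective fun J : Ideal (𝓞 K) => P * J :=
      mul_right_injective₀ hP0
    rw [← hinj.tsum_eq, sievedZeta, ← tsum_mul_left]
    · refine tsum_congr fun J => ?_
      simp only [hmul, dvd_mul_right, true_and, mul_ite, mul_zero]
      refine if_congr Iff.rfl ?_ rfl
      rw [map_mul, Nat.cast_mul, Real.mul_rpow (by positivity) (by positivity)]
    · intro I hI
      rw [Function.mem_support, ne_eq, ite_eq_right_iff, Classical.not_imp] at hI
      obtain ⟨J, hJ⟩ := hI.1.1
      exact ⟨J, hJ.symm⟩
  rw [sub_mul, one_mul, ← hremoved, eq_sub_iff_add_eq, sievedZeta, sievedZeta,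
    ← (summable_sieved hs fun I => ∀ Q ∈ insert P S, ¬ Q ∣ I).tsum_add
      (summable_sieved hs fun I => P ∣ I ∧ ∀ Q ∈ S, ¬ Q ∣ I)]
  refine tsum_congr fun I => ?_
  by_cases h1 : P ∣ I <;> by_cases h2 : ∀ Q ∈ S, ¬ Q ∣ I <;> simp [h1, h2]

theorem sievedZeta_eq_prod {S : Finset (Ideal (𝓞 K))} (hS : ∀ Q ∈ S, Q.IsPrime ∧ Q ≠ ⊥)
    {s : ℝ} (hs : 1 < s) :
    sievedZeta K S s =
      (∏ P ∈ S, (1 - (absNorm P : ℝ) ^ (-s))) * ∑' I : Ideal (𝓞 K), (absNorm I : ℝ) ^ (-s) := by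
  classical
  induction S using Finset.induction_on with
  | empty => simp [sievedZeta]
  | insert P S hPS ih =>
    have h1 := hS P (mem_insert_self P S)
    have h2 : ∀ Q ∈ S, Q.IsPrime ∧ Q ≠ ⊥ := fun Q hQ => hS Q (mem_insert_of_mem hQ)
    rw [sievedZeta_insert h2 h1.1 h1.2 hPS hs, ih h2, prod_insert hPS, mul_assoc]

/-- Sieving by an increasing sequence of sets that exhausts the nonzero primes leaves only the unit
ideal in the limit. -/
theorem tendsto_sievedZeta {S : ℕ → Finset (Ideal (𝓞 K))}
    (hS : ∀ N, ∀ Q ∈ S N, Q.IsPrime ∧ Q ≠ ⊥)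
    (hex : ∀ P : Ideal (𝓞 K), P.IsPrime → P ≠ ⊥ → ∀ᶠ N in atTop, P ∈ S N) {s : ℝ} (hs : 1 < s) :
    Tendsto (fun N => sievedZeta K (S N) s) atTop (𝓝 1) := by
  classical
  have hlim : ∑' I : Ideal (𝓞 K), (if I = ⊤ then (1 : ℝ) else 0) = 1 := by
    rw [tsum_ite_eq]
  rw [← hlim]
  refine tendsto_tsum_of_dominated_convergence (summable_absNorm_rpow K hs) (fun I => ?_)
    (Eventually.of_forall fun N I => ?_)
  · by_cases hI : I = ⊤
    · refine tendsto_const_nhds.congr fun N => ?_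
      rw [if_pos hI, if_pos, hI]
      · simp
      · intro P hP hdvd
        rw [hI] at hdvd
        exact (hS N P hP).1.ne_top (top_le_iff.1 (le_of_dvd hdvd))
    · rw [if_neg hI]
      by_cases hI0 : I = ⊥
      · refine tendsto_const_nhds.congr fun N => ?_
        rw [hI0, absNorm_bot, Nat.cast_zero, Real.zero_rpow (by linarith), ite_self]
      · obtain ⟨P, hPmax, hIP⟩ := exists_le_maximal I hI
        refine tendsto_const_nhds.congr' ?_
        filter_upwards [hex P hPmax.isPrime fun h => hI0 (le_bot_iff.1 (h ▸ hIP))] with N hN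
        rw [if_neg]
        exact fun h => h P hN (dvd_iff_le.2 hIP)
  · rw [Real.norm_of_nonneg (by split_ifs <;> positivity)]
    split_ifs
    · exact le_rfl
    · positivity

variable (K) in
/-- The finite set of primes of `K` above a rational prime `p`. -/
noncomputable def primesAbove (p : ℕ) [Fact p.Prime] : Finset (Ideal (𝓞 K)) :=
  (Algebra.QuasiFinite.finite_primesOver (S := 𝓞 K) (span {(p : ℤ)})).toFinset

variable (K) in
open scoped Classical in
/-- The Euler factor at `p` of `1 / ζ_K(s)`, as a product over the primes above `p`; it is `1` if
`p` is not prime. -/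
noncomputable def localFactor (s : ℝ) (p : ℕ) : ℝ :=
  if hp : p.Prime then
    have : Fact p.Prime := ⟨hp⟩
    ∏ P ∈ primesAbove K p, (1 - (absNorm P : ℝ) ^ (-s))
  else 1

theorem mem_primesAbove {p : ℕ} [Fact p.Prime] {P : Ideal (𝓞 K)} :
    P ∈ primesAbove K p ↔ P.IsPrime ∧ P.LiesOver (span {(p : ℤ)}) := by
  rw [primesAbove, Set.Finite.mem_toFinset]
  rfl

theorem ne_bot_of_mem_primesAbove {p : ℕ} [hp : Fact p.Prime] {P : Ideal (𝓞 K)}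
    (hP : P ∈ primesAbove K p) : P ≠ ⊥ := by
  have := (mem_primesAbove.1 hP).2
  exact ne_bot_of_liesOver_of_ne_bot (p := span {(p : ℤ)}) (by simpa using hp.out.ne_zero) P

theorem absNorm_under_of_mem_primesAbove {p : ℕ} [hp : Fact p.Prime] {P : Ideal (𝓞 K)}
    (hP : P ∈ primesAbove K p) : absNorm (under ℤ P) = p := by
  have := (mem_primesAbove.1 hP).2
  rw [← over_def P (span {(p : ℤ)})]
  simp

theorem mem_primesAbove_absNorm_under {P : Ideal (𝓞 K)} (hP : P.IsPrime)
    [Fact (absNorm (under ℤ P)).Prime] : P ∈ primesAbove K (absNorm (under ℤ P)) :=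
  mem_primesAbove.2 ⟨hP, inferInstance⟩

/-- The **Euler product** of `ζ_K(s)` for real `s > 1`, grouped by rational primes. -/
theorem tendsto_prod_localFactor_mul {s : ℝ} (hs : 1 < s) :
    Tendsto (fun N : ℕ => (∏ p ∈ range N, localFactor K s p) *
      ∑' I : Ideal (𝓞 K), (absNorm I : ℝ) ^ (-s)) atTop (𝓝 1) := by
  classical
  set A : ℕ → Finset (Ideal (𝓞 K)) := fun p =>
    if hp : p.Prime then
      have : Fact p.Prime := ⟨hp⟩
      primesAbove K p
    else ∅ with hA
  have hAmem : ∀ p P, P ∈ A p → P.IsPrime ∧ P ≠ ⊥ ∧ absNorm (under ℤ P) = p := by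
    intro p P hP
    simp only [hA] at hP
    split_ifs at hP with hp
    · have : Fact p.Prime := ⟨hp⟩
      exact ⟨(mem_primesAbove.1 hP).1, ne_bot_of_mem_primesAbove hP,
        absNorm_under_of_mem_primesAbove hP⟩
    · simp at hP
  have hAprod : ∀ p, ∏ P ∈ A p, (1 - (absNorm P : ℝ) ^ (-s)) = localFactor K s p := by
    intro p
    simp only [hA, localFactor]
    split_ifs with hp
    · rfl
    · simp
  have hSprime : ∀ N, ∀ Q ∈ (range N).biUnion A, Q.IsPrime ∧ Q ≠ ⊥ := by
    intro N Q hQ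
    obtain ⟨p, _, hp⟩ := mem_biUnion.1 hQ
    exact ⟨(hAmem p Q hp).1, (hAmem p Q hp).2.1⟩
  have hlim := tendsto_sievedZeta (S := fun N => (range N).biUnion A) hSprime ?_ hs
  · refine hlim.congr fun N => ?_
    rw [sievedZeta_eq_prod (hSprime N) hs, prod_biUnion]
    · rw [prod_congr rfl fun p _ => hAprod p]
    · intro p _ r _ hpr
      rw [Function.onFun, disjoint_left]
      intro P hP hP'
      exact hpr ((hAmem p P hP).2.2.symm.trans (hAmem r P hP').2.2)
  · intro P hP hP0
    have : NeZero P := ⟨hP0⟩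
    have hpr := Nat.absNorm_under_prime P
    filter_upwards [eventually_gt_atTop (absNorm (under ℤ P))] with N hN
    refine mem_biUnion.2 ⟨_, mem_range.2 hN, ?_⟩
    have : Fact (absNorm (under ℤ P)).Prime := ⟨hpr⟩
    simp only [hA, hpr, dif_pos]
    exact mem_primesAbove_absNorm_under hP

end DedekindZeta

/-! ### The local factors of the cyclotomic field -/

section Cyclotomic

open NumberField Ideal

theorem localFactor_eq_pow {K : Type*} [Field K] [NumberField K] {p d : ℕ} (hp : p.Prime)
    (hd : ∀ P : Ideal (𝓞 K), P.IsPrime → P.LiesOver (span {(p : ℤ)}) → P.inertiaDeg ℤ = d)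
    (s : ℝ) : localFactor K s p =
      (1 - ((p : ℝ) ^ (-s)) ^ d) ^ ((span {(p : ℤ)}).primesOver (𝓞 K)).ncard := by
  have : Fact p.Prime := ⟨hp⟩
  rw [localFactor, dif_pos hp, Set.ncard_eq_toFinset_card _ (Algebra.QuasiFinite.finite_primesOver _)]
  refine prod_eq_pow_card fun P hP => ?_
  obtain ⟨h1, h2⟩ := mem_primesAbove.1 hP
  rw [← pow_inertiaDeg p P, hd P h1 h2, Nat.cast_pow, ← Real.rpow_natCast, ← Real.rpow_natCast,
    ← Real.rpow_mul (by positivity), ← Real.rpow_mul (by positivity), mul_comm]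

theorem localFactor_cyclotomic_self (K : Type*) [Field K] [NumberField K] {q : ℕ}
    [IsCyclotomicExtension {q} ℚ K] (hq : q.Prime) (s : ℝ) :
    localFactor K s q = 1 - (q : ℝ) ^ (-s) := by
  have : Fact q.Prime := ⟨hq⟩
  rw [localFactor_eq_pow hq (d := 1)
    (fun P _ _ => IsCyclotomicExtension.Rat.inertiaDeg_eq_of_prime q _ P),
    IsCyclotomicExtension.Rat.ncard_primesOver_of_prime, pow_one, pow_one]

theorem localFactor_cyclotomic (K : Type*) [Field K] [NumberField K] {q p : ℕ}
    [IsCyclotomicExtension {q} ℚ K] (hq : q.Prime) (hp : p.Prime) (hpq : p ≠ q) (s : ℝ) :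
    localFactor K s p =
      (1 - ((p : ℝ) ^ (-s)) ^ f q p) ^ ((q - 1) / f q p) := by
  have : Fact q.Prime := ⟨hq⟩
  have : Fact p.Prime := ⟨hp⟩
  have : NeZero q := ⟨hq.ne_zero⟩
  have hdvd : ¬ p ∣ q := fun h => hpq ((Nat.prime_dvd_prime_iff_eq hp hq).1 h)
  rw [localFactor_eq_pow hp (d := f q p)
    (fun P _ _ => IsCyclotomicExtension.Rat.inertiaDeg_eq_of_not_dvd p _ P hdvd)]
  congr 1
  have : IsGalois ℚ K := IsCyclotomicExtension.isGalois {q} ℚ _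
  have h := ncard_primesOver_mul_ramificationIdxIn_mul_inertiaDegIn (span {(p : ℤ)})
    (𝓞 K) Gal(K/ℚ)
  rw [IsCyclotomicExtension.Rat.ramificationIdxIn_eq_of_not_dvd p _ hdvd,
    IsCyclotomicExtension.Rat.inertiaDegIn_eq_of_not_dvd p _ hdvd, one_mul,
    IsGaloisGroup.card_eq_finrank Gal(K/ℚ) ℚ K,
    IsCyclotomicExtension.Rat.finrank q, Nat.totient_prime hq] at h
  refine (Nat.div_eq_of_eq_mul_left ?_ h.symm).symm
  by_contra h0
  have h0' : orderOf (p : ZMod q) = 0 := by simpa [f] using h0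
  rw [h0', mul_zero] at h
  have := hq.two_le
  omega

/-- The cyclotomic field is a cyclotomic extension for the canonical `ℚ`-algebra structure of a
field of characteristic zero. -/
instance isCyclotomicExtension_rat (q : ℕ) :
    @IsCyclotomicExtension {q} ℚ (CyclotomicField q ℚ) _ _ DivisionRing.toRatAlgebra := by
  rw [Subsingleton.elim (DivisionRing.toRatAlgebra : Algebra ℚ (CyclotomicField q ℚ))
    (CyclotomicField.algebra q ℚ)]
  infer_instance

end Cyclotomic

theorem f_eq_one_iff {q p : ℕ} : f q p = 1 ↔ p ≡ 1 [MOD q] := by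
  rw [f, orderOf_eq_one_iff, ← ZMod.natCast_eq_natCast_iff, Nat.cast_one]

theorem f_pos {q p : ℕ} (hq : q.Prime) (hp : p.Prime) (hpq : p ≠ q) : 0 < f q p := by
  have : Fact q.Prime := ⟨hq⟩
  have hne : (p : ZMod q) ≠ 0 := by
    rw [Ne, ZMod.natCast_eq_zero_iff, Nat.prime_dvd_prime_iff_eq hq hp]
    exact fun h => hpq h.symm
  exact orderOf_pos_iff.2 (isOfFinOrder_iff_pow_eq_one.2
    ⟨q - 1, by have := hq.two_le; omega, ZMod.pow_card_sub_one_eq_one hne⟩)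

theorem not_modEq_one_self {q : ℕ} (hq : q.Prime) : ¬ q ≡ 1 [MOD q] := by
  intro h
  have := hq.two_le
  rw [Nat.ModEq, Nat.mod_self, Nat.mod_eq_of_lt (by omega)] at h
  omega

/-! ### The logarithm of the Dedekind zeta function near `s = 1` -/

/-- The contribution `-log (1 - p ^ (-s))` of a prime `p ≡ 1` modulo `q`. -/
noncomputable def splitTerm (q : ℕ) (s : ℝ) (p : ℕ) : ℝ :=
  if p.Prime ∧ p ≡ 1 [MOD q] then -Real.log (1 - (p : ℝ) ^ (-s)) else 0

/-- The contribution to `log ζ_K(s)` of a prime `p ≠ q` with `f_p ≥ 2`. -/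
noncomputable def nonsplitTerm (q : ℕ) (s : ℝ) (p : ℕ) : ℝ :=
  if p.Prime ∧ p ≠ q ∧ 2 ≤ f q p then
    -Real.log ((1 - ((p : ℝ) ^ (-s)) ^ f q p) ^ ((q - 1) / f q p)) else 0

/-- The contribution to `log ζ_K(s)` of the ramified prime `q`. -/
noncomputable def ramifiedTerm (q : ℕ) (s : ℝ) (p : ℕ) : ℝ :=
  if p = q then -Real.log (1 - (q : ℝ) ^ (-s)) else 0

theorem neg_log_localFactor {q : ℕ} (hq : q.Prime) (s : ℝ) (p : ℕ) :
    -Real.log (localFactor (CyclotomicField q ℚ) s p) =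
      ((q : ℝ) - 1) * splitTerm q s p + (nonsplitTerm q s p + ramifiedTerm q s p) := by
  by_cases hp : p.Prime
  · by_cases hpq : p = q
    · subst hpq
      simp [splitTerm, nonsplitTerm, ramifiedTerm, not_modEq_one_self hp,
        localFactor_cyclotomic_self _ hp]
    · rw [localFactor_cyclotomic _ hq hp hpq]
      by_cases h1 : p ≡ 1 [MOD q]
      · have hf := f_eq_one_iff.2 h1
        have : ((q - 1 : ℕ) : ℝ) = q - 1 := by
          rw [Nat.cast_sub hq.one_le, Nat.cast_one]
        simp [splitTerm, nonsplitTerm, ramifiedTerm, hp, hpq, h1, hf, this]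
      · have hf : f q p ≠ 1 := fun h => h1 (f_eq_one_iff.1 h)
        have hf2 : 2 ≤ f q p := by
          have := f_pos hq hp hpq
          omega
        simp [splitTerm, nonsplitTerm, ramifiedTerm, hp, hpq, h1, hf2]
  · have hpq : p ≠ q := fun h => hp (h ▸ hq)
    simp [splitTerm, nonsplitTerm, ramifiedTerm, hp, hpq, localFactor]

theorem rpow_neg_le_half {p : ℕ} (hp : 2 ≤ p) {s : ℝ} (hs : 1 ≤ s) : (p : ℝ) ^ (-s) ≤ 1 / 2 := by
  have hp' : (2 : ℝ) ≤ p := by exact_mod_cast hp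
  calc (p : ℝ) ^ (-s) ≤ (p : ℝ) ^ (-1 : ℝ) :=
        Real.rpow_le_rpow_of_exponent_le (by linarith) (by linarith)
    _ = 1 / p := by rw [Real.rpow_neg_one, one_div]
    _ ≤ 1 / 2 := one_div_le_one_div_of_le (by norm_num) hp'

theorem neg_log_one_sub_le {y : ℝ} (hy0 : 0 ≤ y) (hy : y ≤ 1 / 2) : -Real.log (1 - y) ≤ 2 * y := by
  have h := (abs_le.1 (abs_neg_log_one_sub_sub_le hy0 hy)).2
  nlinarith

theorem splitTerm_nonneg (q : ℕ) {s : ℝ} (hs : 1 ≤ s) (p : ℕ) : 0 ≤ splitTerm q s p := by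
  unfold splitTerm
  split_ifs with h
  · have h1 := rpow_neg_le_half h.1.two_le hs
    have h2 : 0 ≤ (p : ℝ) ^ (-s) := by positivity
    exact neg_nonneg.2 (Real.log_nonpos (by linarith) (by linarith))
  · exact le_rfl

theorem summable_splitTerm (q : ℕ) {s : ℝ} (hs : 1 < s) : Summable (splitTerm q s) := by
  refine Summable.of_nonneg_of_le (splitTerm_nonneg q hs.le) (fun p => ?_)
    ((Real.summable_nat_rpow.2 (show -s < -1 by linarith)).mul_left 2)
  unfold splitTerm
  split_ifs with h
  · exact neg_log_one_sub_le (by positivity) (rpow_neg_le_half h.1.two_le hs.le)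
  · positivity

theorem pow_rpow_neg_le_half {q p : ℕ} (hp : 2 ≤ p) (hf : 2 ≤ f q p) {s : ℝ} (hs : 1 ≤ s) :
    ((p : ℝ) ^ (-s)) ^ f q p ≤ 1 / 2 := by
  have h := rpow_neg_le_half hp hs
  exact (pow_le_of_le_one (by positivity) (by linarith) (by omega)).trans h

theorem nonsplitTerm_nonneg (q : ℕ) {s : ℝ} (hs : 1 ≤ s) (p : ℕ) : 0 ≤ nonsplitTerm q s p := by
  unfold nonsplitTerm
  split_ifs with h
  · have h1 := pow_rpow_neg_le_half h.1.two_le h.2.2 hs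
    have h2 : 0 ≤ ((p : ℝ) ^ (-s)) ^ f q p := by positivity
    rw [Real.log_pow, ← mul_neg]
    exact mul_nonneg (by positivity) (neg_nonneg.2 (Real.log_nonpos (by linarith) (by linarith)))
  · exact le_rfl

theorem nonsplitTerm_le (q : ℕ) {s : ℝ} (hs : 1 ≤ s) (p : ℕ) :
    nonsplitTerm q s p ≤ nonsplitTerm q 1 p := by
  unfold nonsplitTerm
  split_ifs with h
  · have h1 := pow_rpow_neg_le_half h.1.two_le h.2.2 le_rfl
    have h3 : ((p : ℝ) ^ (-s)) ^ f q p ≤ ((p : ℝ) ^ (-1 : ℝ)) ^ f q p := by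
      have : (1 : ℝ) ≤ p := by exact_mod_cast h.1.one_le
      gcongr
    refine neg_le_neg (Real.log_le_log (pow_pos (by linarith) _) ?_)
    gcongr
    linarith
  · exact le_rfl

theorem summable_nonsplitTerm_one (q : ℕ) : Summable (nonsplitTerm q 1) := by
  refine Summable.of_nonneg_of_le (nonsplitTerm_nonneg q le_rfl) (fun p => ?_)
    ((Real.summable_one_div_nat_pow.2 one_lt_two).mul_left (2 * (q : ℝ)))
  unfold nonsplitTerm
  split_ifs with h
  · have h1 := pow_rpow_neg_le_half h.1.two_le h.2.2 (le_refl (1 : ℝ))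
    have hy := rpow_neg_le_half h.1.two_le (le_refl (1 : ℝ))
    have h3 := neg_log_one_sub_le (by positivity) h1
    have h4 : ((p : ℝ) ^ (-1 : ℝ)) ^ f q p ≤ 1 / (p : ℝ) ^ 2 := by
      rw [one_div, ← inv_pow, ← Real.rpow_neg_one]
      exact pow_le_pow_of_le_one (by positivity) (by linarith) h.2.2
    have h5 : (((q - 1) / f q p : ℕ) : ℝ) ≤ q := by
      exact_mod_cast (Nat.div_le_self _ _).trans (Nat.sub_le _ _)
    rw [Real.log_pow, ← mul_neg]
    calc _ ≤ (q : ℝ) * (2 * (1 / (p : ℝ) ^ 2)) := by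
          refine mul_le_mul h5 (h3.trans (by linarith)) ?_ (by positivity)
          have h2 : 0 ≤ ((p : ℝ) ^ (-1 : ℝ)) ^ f q p := by positivity
          exact neg_nonneg.2 (Real.log_nonpos (by linarith) (by linarith))
      _ = _ := by ring
  · positivity

theorem continuousAt_nonsplitTerm (q p : ℕ) : ContinuousAt (fun s => nonsplitTerm q s p) 1 := by
  unfold nonsplitTerm
  split_ifs with h
  · have h1 := pow_rpow_neg_le_half h.1.two_le h.2.2 (le_refl (1 : ℝ))
    have hp : (p : ℝ) ≠ 0 := by exact_mod_cast h.1.ne_zero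
    have hc : ContinuousAt (fun s : ℝ => (p : ℝ) ^ (-s)) 1 :=
      (Real.continuous_const_rpow hp).continuousAt.comp continuous_neg.continuousAt
    exact (((continuousAt_const.sub (hc.pow _)).pow _).log
      (pow_ne_zero _ (show (1 : ℝ) - ((p : ℝ) ^ (-1 : ℝ)) ^ f q p ≠ 0 by linarith))).neg
  · exact continuousAt_const

theorem tendsto_tsum_nonsplitTerm (q : ℕ) :
    Tendsto (fun s => ∑' p, nonsplitTerm q s p) (𝓝[>] 1) (𝓝 (∑' p, nonsplitTerm q 1 p)) := by
  refine tendsto_tsum_of_dominated_convergence (summable_nonsplitTerm_one q)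
    (fun p => (continuousAt_nonsplitTerm q p).tendsto.mono_left nhdsWithin_le_nhds) ?_
  filter_upwards [self_mem_nhdsWithin] with s hs p
  have hs' : (1 : ℝ) ≤ s := le_of_lt hs
  rw [Real.norm_of_nonneg (nonsplitTerm_nonneg q hs' p)]
  exact nonsplitTerm_le q hs' p

/-- The contribution of the primes with `f_p ≥ 2` at `s = 1` is `-log C(q)`. -/
theorem exp_neg_tsum_nonsplitTerm (q : ℕ) : Real.exp (-∑' p, nonsplitTerm q 1 p) = C1 q := by
  set S : Set ℕ := {p : ℕ | p.Prime ∧ p ≠ q ∧ 2 ≤ f q p} with hS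
  have hval : ∀ p : S, -nonsplitTerm q 1 p =
      Real.log ((1 - 1 / (p.1 : ℝ) ^ f q p) ^ ((q - 1) / f q p)) := by
    intro p
    have hp : p.1.Prime ∧ p.1 ≠ q ∧ 2 ≤ f q p := p.2
    rw [nonsplitTerm, if_pos hp, neg_neg, Real.rpow_neg_one, inv_pow, one_div]
  have hsub : ∑' p : S, nonsplitTerm q 1 p = ∑' p, nonsplitTerm q 1 p := by
    refine tsum_subtype_eq_of_support_subset fun p hp => ?_
    by_contra h
    exact hp (if_neg h)
  have hsum : Summable fun p : S => -nonsplitTerm q 1 p :=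
    ((summable_nonsplitTerm_one q).subtype S).neg
  rw [← hsub, ← tsum_neg, tsum_congr hval, Real.rexp_tsum_eq_tprod _ (hsum.congr hval)]
  · rfl
  · intro p
    have h1 := pow_rpow_neg_le_half p.2.1.two_le p.2.2.2 (le_refl (1 : ℝ))
    rw [Real.rpow_neg_one, inv_pow, ← one_div] at h1
    exact pow_pos (by linarith) _

theorem C1_pos (q : ℕ) : 0 < C1 q := exp_neg_tsum_nonsplitTerm q ▸ Real.exp_pos _

theorem hasSum_ramifiedTerm (q : ℕ) (s : ℝ) :
    HasSum (ramifiedTerm q s) (-Real.log (1 - (q : ℝ) ^ (-s))) := by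
  have := hasSum_ite_eq q (-Real.log (1 - (q : ℝ) ^ (-s)))
  exact this

theorem localFactor_pos {q : ℕ} (hq : q.Prime) {s : ℝ} (hs : 1 ≤ s) (p : ℕ) :
    0 < localFactor (CyclotomicField q ℚ) s p := by
  by_cases hp : p.Prime
  · have h := rpow_neg_le_half hp.two_le hs
    by_cases hpq : p = q
    · subst hpq
      rw [localFactor_cyclotomic_self _ hp]
      linarith
    · rw [localFactor_cyclotomic _ hq hp hpq]
      have := pow_le_of_le_one (by positivity) (by linarith) (f_pos hq hp hpq).ne'
        (a := (p : ℝ) ^ (-s))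
      exact pow_pos (by linarith) _
  · simp [localFactor, hp]

open NumberField Ideal in
/-- The decomposition of `log ζ_K(s)` for `K = ℚ(ζ_q)` according to the splitting type of the
primes. -/
theorem log_zeta_eq {q : ℕ} (hq : q.Prime) {s : ℝ} (hs : 1 < s) :
    Real.log (∑' I : Ideal (𝓞 (CyclotomicField q ℚ)), (absNorm I : ℝ) ^ (-s)) =
      ((q : ℝ) - 1) * ∑' p, splitTerm q s p +
        (∑' p, nonsplitTerm q s p - Real.log (1 - (q : ℝ) ^ (-s))) := by
  set Z := ∑' I : Ideal (𝓞 (CyclotomicField q ℚ)), (absNorm I : ℝ) ^ (-s) with hZ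
  have hZpos : 0 < Z := by
    refine (summable_absNorm_rpow _ hs).tsum_pos (fun _ => by positivity) ⊤ ?_
    simp
  have hnon : Summable (nonsplitTerm q s) :=
    Summable.of_nonneg_of_le (nonsplitTerm_nonneg q hs.le) (nonsplitTerm_le q hs.le)
      (summable_nonsplitTerm_one q)
  have h1 := ((summable_splitTerm q hs).hasSum.mul_left ((q : ℝ) - 1)).add
    (hnon.hasSum.add (hasSum_ramifiedTerm q s))
  rw [← funext (neg_log_localFactor hq s), ← sub_eq_add_neg] at h1
  have h2 := (tendsto_prod_localFactor_mul (K := CyclotomicField q ℚ) hs).log one_ne_zero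
  rw [Real.log_one] at h2
  have h3 := h1.tendsto_sum_nat.add h2
  rw [add_zero] at h3
  refine tendsto_nhds_unique (tendsto_const_nhds.congr fun N => ?_) h3
  rw [Real.log_mul (prod_pos fun p _ => localFactor_pos hq hs.le p).ne' hZpos.ne',
    Real.log_prod fun p _ => (localFactor_pos hq hs.le p).ne', sum_neg_distrib]
  ring

open NumberField Ideal in
theorem tendsto_log_zeta_add_log (q : ℕ) :
    Tendsto (fun s : ℝ => Real.log (∑' I : Ideal (𝓞 (CyclotomicField q ℚ)),
      (absNorm I : ℝ) ^ (-s)) + Real.log (s - 1)) (𝓝[>] 1) (𝓝 (Real.log (alpha q))) := by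
  have hpos : 0 < alpha q := by
    rw [alpha_eq]
    exact dedekindZeta_residue_pos _
  have h := Complex.continuous_re.continuousAt.tendsto.comp (tendsto_alpha q)
  refine (h.log (by simpa using hpos.ne')).congr' ?_
  filter_upwards [self_mem_nhdsWithin] with s hs
  have hs' : 1 < s := hs
  have hZpos : 0 < ∑' I : Ideal (𝓞 (CyclotomicField q ℚ)), (absNorm I : ℝ) ^ (-s) := by
    refine (summable_absNorm_rpow _ hs').tsum_pos (fun _ => by positivity) ⊤ ?_
    simp
  rw [Function.comp_apply, dedekindZeta_eq_tsum_absNorm _ hs', ← Complex.ofReal_one,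
    ← Complex.ofReal_sub, ← Complex.ofReal_mul, Complex.ofReal_re,
    Real.log_mul (by linarith) hZpos.ne', add_comm]

theorem primeWeight_nonneg (q n : ℕ) : 0 ≤ primeWeight q n := by
  have := splitTerm_nonneg q le_rfl n
  rwa [splitTerm, Real.rpow_neg_one, ← one_div] at this

theorem summable_primeWeight_mul_rpow (q : ℕ) {δ : ℝ} (hδ : 0 < δ) :
    Summable fun n : ℕ => primeWeight q n * (n : ℝ) ^ (-δ) := by
  refine Summable.of_nonneg_of_le (fun n => mul_nonneg (primeWeight_nonneg q n) (by positivity))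
    (fun n => ?_) ((Real.summable_nat_rpow.2 (show -(1 + δ) < -1 by linarith)).mul_left 2)
  unfold primeWeight
  split_ifs with h
  · have hn : (0 : ℝ) < n := by exact_mod_cast h.1.pos
    have h1 := neg_log_one_sub_le (y := 1 / (n : ℝ)) (by positivity)
      (one_div_le_one_div_of_le (by norm_num) (by exact_mod_cast h.1.two_le))
    rw [neg_add, Real.rpow_add hn, Real.rpow_neg_one, ← one_div, ← mul_assoc]
    gcongr
  · rw [zero_mul]
    positivity

/-- The series of `-log (1 - p ^ (-1-δ))` and of `-log (1 - 1/p) p ^ (-δ)` have the same behaviour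
as `δ → 0+`, since the difference of their terms is `O(1 / p²)`. -/
theorem tendsto_tsum_splitTerm_sub (q : ℕ) :
    Tendsto (fun δ : ℝ => ∑' p, splitTerm q (1 + δ) p - ∑' p : ℕ, primeWeight q p * (p : ℝ) ^ (-δ))
      (𝓝[>] 0) (𝓝 0) := by
  have hlim : Tendsto (fun δ : ℝ =>
      ∑' p : ℕ, (splitTerm q (1 + δ) p - primeWeight q p * (p : ℝ) ^ (-δ)))
      (𝓝[>] 0) (𝓝 (∑' _ : ℕ, (0 : ℝ))) := by
    refine tendsto_tsum_of_dominated_convergence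
      ((Real.summable_one_div_nat_pow.2 one_lt_two).mul_left 4) (fun p => ?_) ?_
    · by_cases h : p.Prime ∧ p ≡ 1 [MOD q]
      · simp only [splitTerm, primeWeight, h, and_self, if_true]
        have hp : (p : ℝ) ≠ 0 := by exact_mod_cast h.1.ne_zero
        have hy := rpow_neg_le_half h.1.two_le (le_refl (1 : ℝ))
        have hc1 : ContinuousAt (fun δ : ℝ => (p : ℝ) ^ (-(1 + δ))) 0 :=
          (Real.continuous_const_rpow hp).continuousAt.comp (by fun_prop)
        have hc2 : ContinuousAt (fun δ : ℝ => (p : ℝ) ^ (-δ)) 0 :=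
          (Real.continuous_const_rpow hp).continuousAt.comp (by fun_prop)
        have hc : ContinuousAt (fun δ : ℝ => -Real.log (1 - (p : ℝ) ^ (-(1 + δ))) -
            -Real.log (1 - 1 / (p : ℝ)) * (p : ℝ) ^ (-δ)) 0 :=
          (((continuousAt_const (y := (1 : ℝ))).sub hc1).log
            (show (1 : ℝ) - (p : ℝ) ^ (-(1 + 0) : ℝ) ≠ 0 by rw [add_zero]; linarith)).neg.sub
            (hc2.const_mul (-Real.log (1 - 1 / (p : ℝ))))
        have := hc.tendsto.mono_left (nhdsWithin_le_nhds (s := Set.Ioi 0))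
        simpa [Real.rpow_neg_one] using this
      · simp [splitTerm, primeWeight, h]
    · filter_upwards [self_mem_nhdsWithin] with δ hδ p
      have hδ' : 0 < δ := hδ
      by_cases h : p.Prime ∧ p ≡ 1 [MOD q]
      · simp only [splitTerm, primeWeight, h, and_self, if_true]
        have hp1 : (1 : ℝ) ≤ p := by exact_mod_cast h.1.one_le
        have hp : (0 : ℝ) < p := by linarith
        set y := 1 / (p : ℝ) with hy
        set t := (p : ℝ) ^ (-δ) with ht
        have ht0 : 0 ≤ t := by positivity
        have ht1 : t ≤ 1 := Real.rpow_le_one_of_one_le_of_nonpos hp1 (by linarith)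
        have hy0 : 0 ≤ y := by positivity
        have hy2 : y ≤ 1 / 2 :=
          one_div_le_one_div_of_le (by norm_num) (by exact_mod_cast h.1.two_le)
        have e : (p : ℝ) ^ (-(1 + δ)) = y * t := by
          rw [neg_add, Real.rpow_add hp, Real.rpow_neg_one, hy, one_div]
        have hyt : y * t ≤ y := mul_le_of_le_one_right hy0 ht1
        have h1 := abs_neg_log_one_sub_sub_le (mul_nonneg hy0 ht0) (hyt.trans hy2)
        have h2 := abs_neg_log_one_sub_sub_le hy0 hy2
        have e2 : -Real.log (1 - y * t) - -Real.log (1 - y) * t =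
            (-Real.log (1 - y * t) - y * t) - (-Real.log (1 - y) - y) * t := by ring
        rw [e, e2, Real.norm_eq_abs]
        refine (abs_sub _ _).trans ?_
        rw [abs_mul, abs_of_nonneg ht0]
        have h3 : |-Real.log (1 - y) - y| * t ≤ 2 * y ^ 2 :=
          (mul_le_of_le_one_right (abs_nonneg _) ht1).trans h2
        have h4 : (y * t) ^ 2 ≤ y ^ 2 := pow_le_pow_left₀ (mul_nonneg hy0 ht0) hyt 2
        have h5 : 1 / (p : ℝ) ^ 2 = y ^ 2 := by rw [hy, one_div_pow]
        rw [h5]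
        linarith
      · simp [splitTerm, primeWeight, h]
  rw [tsum_zero] at hlim
  refine hlim.congr' ?_
  filter_upwards [self_mem_nhdsWithin] with δ hδ
  have hδ' : 0 < δ := hδ
  refine (summable_splitTerm q (by linarith)).tsum_sub (summable_primeWeight_mul_rpow q hδ')

/-- **The constant in Mertens' theorem.** Both `M` and the residue `α(q)` are read off from
`log ζ_K(1 + δ)` as `δ → 0+`. -/
theorem mertens_constant {q : ℕ} (hq : q.Prime) {M : ℝ}
    (hM : Tendsto (fun x : ℝ => ∑ n ∈ Icc 0 ⌊x⌋₊, primeWeight q n -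
      1 / ((q : ℝ) - 1) * Real.log (Real.log x)) atTop (𝓝 M)) :
    ((q : ℝ) - 1) * M = Real.eulerMascheroniConstant + Real.log (alpha q) +
      Real.log (1 - 1 / (q : ℝ)) + Real.log (C1 q) := by
  have hq1 : (q : ℝ) - 1 ≠ 0 := by
    have : (1 : ℝ) < q := by exact_mod_cast hq.one_lt
    linarith
  have h1 := tendsto_tsum_mul_rpow_sub_log (primeWeight_nonneg q) (by simp [primeWeight]) hM
    fun δ hδ => summable_primeWeight_mul_rpow q hδ
  have h2 := ((tendsto_tsum_splitTerm_sub q).add h1).const_mul ((q : ℝ) - 1)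
  have hshift : Tendsto (fun δ : ℝ => 1 + δ) (𝓝[>] 0) (𝓝[>] 1) := by
    refine tendsto_nhdsWithin_iff.2 ⟨?_, ?_⟩
    · have : Continuous fun δ : ℝ => 1 + δ := by fun_prop
      simpa using (this.tendsto 0).mono_left (nhdsWithin_le_nhds (s := Set.Ioi 0))
    · filter_upwards [self_mem_nhdsWithin] with δ hδ
      have : 0 < δ := hδ
      simpa using this
  have h3 := (tendsto_log_zeta_add_log q).comp hshift
  have h4 := (tendsto_tsum_nonsplitTerm q).comp hshift
  have h5 : Tendsto (fun δ : ℝ => Real.log (1 - (q : ℝ) ^ (-(1 + δ)))) (𝓝[>] 0)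
      (𝓝 (Real.log (1 - 1 / (q : ℝ)))) := by
    have hq0 : (q : ℝ) ≠ 0 := by exact_mod_cast hq.ne_zero
    have hy := rpow_neg_le_half hq.two_le (le_refl (1 : ℝ))
    have hc1 : ContinuousAt (fun δ : ℝ => (q : ℝ) ^ (-(1 + δ))) 0 :=
      (Real.continuous_const_rpow hq0).continuousAt.comp (by fun_prop)
    have hc := ((continuousAt_const (y := (1 : ℝ))).sub hc1).log
      (show (1 : ℝ) - (q : ℝ) ^ (-(1 + 0) : ℝ) ≠ 0 by rw [add_zero]; linarith)
    simpa [Real.rpow_neg_one] using hc.tendsto.mono_left (nhdsWithin_le_nhds (s := Set.Ioi 0))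
  have h6 := tendsto_nhds_unique h3 (((h2.add (h4.sub h5))).congr' ?_)
  · have h7 : Real.log (C1 q) = -∑' p, nonsplitTerm q 1 p := by
      rw [← exp_neg_tsum_nonsplitTerm, Real.log_exp]
    rw [h7, h6]
    field_simp
    ring
  · filter_upwards [self_mem_nhdsWithin] with δ hδ
    have hδ' : 0 < δ := hδ
    simp only [Function.comp_apply]
    rw [log_zeta_eq hq (by linarith), add_sub_cancel_left, one_div δ, Real.log_inv]
    field_simp
    ring

/-! ### The two expressions for the constant `C(q)` -/

theorem isPrimitiveRoot_omega {q : ℕ} (hq : q.Prime) : IsPrimitiveRoot (omega q) (q - 1) := by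
  have := hq.two_le
  have h := Complex.isPrimitiveRoot_exp (q - 1) (by omega)
  rwa [Nat.cast_sub hq.one_le, Nat.cast_one] at h

theorem ind_spec {q g p : ℕ} (hq : q.Prime) (hg : IsPrimitiveRoot (g : ZMod q) (q - 1))
    (hp : p.Prime) (hpq : p ≠ q) : ind q g p < q - 1 ∧ (p : ZMod q) = (g : ZMod q) ^ ind q g p := by
  have : Fact q.Prime := ⟨hq⟩
  have h2 := hq.two_le
  have : NeZero (q - 1) := ⟨by omega⟩
  have hne : (p : ZMod q) ≠ 0 := by
    rw [Ne, ZMod.natCast_eq_zero_iff, Nat.prime_dvd_prime_iff_eq hq hp]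
    exact fun h => hpq h.symm
  obtain ⟨i, hi, hgi⟩ := hg.eq_pow_of_pow_eq_one (ZMod.pow_card_sub_one_eq_one hne)
  have hmem : i ∈ {k : ℕ | p ≡ g ^ k [MOD q]} := by
    rw [Set.mem_ofPred_eq, ← ZMod.natCast_eq_natCast_iff, Nat.cast_pow, hgi]
  refine ⟨(Nat.sInf_le hmem).trans_lt hi, ?_⟩
  have h := Nat.sInf_mem ⟨i, hmem⟩
  rw [Set.mem_ofPred_eq, ← ZMod.natCast_eq_natCast_iff, Nat.cast_pow] at h
  exact h

theorem chi_eq_omega_pow_iff {q g p r : ℕ} (hq : q.Prime)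
    (hg : IsPrimitiveRoot (g : ZMod q) (q - 1)) (hp : p.Prime) (hr : r < q - 1) :
    chi q g p = omega q ^ r ↔ p ≠ q ∧ ind q g p = r := by
  by_cases hpq : p = q
  · subst hpq
    have : omega p ≠ 0 := Complex.exp_ne_zero _
    simp [chi, (pow_ne_zero r this).symm]
  · have hdvd : ¬ q ∣ p := fun h => hpq ((Nat.prime_dvd_prime_iff_eq hq hp).1 h).symm
    rw [chi, if_neg hdvd]
    refine ⟨fun h => ⟨hpq, (isPrimitiveRoot_omega hq).pow_inj (ind_spec hq hg hp hpq).1 hr h⟩,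
      fun h => by rw [h.2]⟩

theorem f_eq_div_gcd_ind {q g p : ℕ} (hq : q.Prime) (hg : IsPrimitiveRoot (g : ZMod q) (q - 1))
    (hp : p.Prime) (hpq : p ≠ q) (h0 : ind q g p ≠ 0) :
    f q p = (q - 1) / Nat.gcd (ind q g p) (q - 1) := by
  rw [f, (ind_spec hq hg hp hpq).2, orderOf_pow' _ h0, ← hg.eq_orderOf, Nat.gcd_comm]

theorem two_le_f_iff {q g p : ℕ} (hq : q.Prime) (hg : IsPrimitiveRoot (g : ZMod q) (q - 1))
    (hp : p.Prime) (hpq : p ≠ q) : 2 ≤ f q p ↔ ind q g p ≠ 0 := by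
  obtain ⟨h1, h2⟩ := ind_spec hq hg hp hpq
  have hpos := f_pos hq hp hpq
  have : f q p = 1 ↔ ind q g p = 0 := by
    rw [f, orderOf_eq_one_iff, h2]
    refine ⟨fun h => ?_, fun h => by rw [h, pow_zero]⟩
    by_contra h0
    exact hg.pow_ne_one_of_pos_of_lt h0 h1 h
  omega

/-- The primes with `f_p ≥ 2` are the disjoint union over `1 ≤ r ≤ q - 2` of the primes of index
`r`, on which `f_p = (q - 1) / (r, q - 1)`. -/
theorem C_eq_C1 {q g : ℕ} (hq : q.Prime) (hg : IsPrimitiveRoot (g : ZMod q) (q - 1)) :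
    C q g = C1 q := by
  set t : ℕ → Set ℕ := fun r => {p : ℕ | p.Prime ∧ chi q g p = omega q ^ r} with ht
  set F : ℕ → ℝ := fun p => (1 - 1 / (p : ℝ) ^ f q p) ^ ((q - 1) / f q p) with hF
  have hlt : ∀ r ∈ Icc 1 (q - 2), r ≠ 0 ∧ r < q - 1 := fun r hr => by
    rw [mem_Icc] at hr
    omega
  have hFt : ∀ r ∈ Icc 1 (q - 2), ∀ p : t r,
      F p = (1 - 1 / (p.1 : ℝ) ^ ((q - 1) / Nat.gcd r (q - 1))) ^ Nat.gcd r (q - 1) := by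
    rintro r hr ⟨p, hp, hchi⟩
    obtain ⟨hpq, hind⟩ := (chi_eq_omega_pow_iff hq hg hp (hlt r hr).2).1 hchi
    have hf := f_eq_div_gcd_ind hq hg hp hpq (hind ▸ (hlt r hr).1)
    rw [hind] at hf
    have hdd : (q - 1) / f q p = Nat.gcd r (q - 1) := by
      rw [hf]
      refine Nat.div_div_self (Nat.gcd_dvd_right _ _) ?_
      have := (hlt r hr).2
      omega
    simp only [hF]
    rw [hdd, hf]
  have hmult : ∀ r ∈ Icc 1 (q - 2), Multipliable (F ∘ (Subtype.val : t r → ℕ)) := fun r hr =>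
    ((multipliable_Cr q g r hr).pow (Nat.gcd r (q - 1))).congr fun p => (hFt r hr p).symm
  have hdisj : (↑(Icc 1 (q - 2)) : Set ℕ).Pairwise (Function.onFun Disjoint t) := by
    intro r hr r' hr' hne
    refine Set.disjoint_left.2 fun p hp hp' => hne ?_
    have h1 := (chi_eq_omega_pow_iff hq hg hp.1 (hlt r hr).2).1 hp.2
    have h2 := (chi_eq_omega_pow_iff hq hg hp.1 (hlt r' hr').2).1 hp'.2
    exact h1.2.symm.trans h2.2
  have hunion : ⋃ r ∈ Icc 1 (q - 2), t r = {p : ℕ | p.Prime ∧ p ≠ q ∧ 2 ≤ f q p} := by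
    ext p
    simp only [Set.mem_iUnion, exists_prop, ht, Set.mem_ofPred_eq]
    constructor
    · rintro ⟨r, hr, hp, hchi⟩
      obtain ⟨hpq, hind⟩ := (chi_eq_omega_pow_iff hq hg hp (hlt r hr).2).1 hchi
      exact ⟨hp, hpq, (two_le_f_iff hq hg hp hpq).2 (hind ▸ (hlt r hr).1)⟩
    · rintro ⟨hp, hpq, hf⟩
      have h0 := (two_le_f_iff hq hg hp hpq).1 hf
      have h1 := (ind_spec hq hg hp hpq).1
      refine ⟨ind q g p, ?_, hp, (chi_eq_omega_pow_iff hq hg hp h1).2 ⟨hpq, rfl⟩⟩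
      rw [mem_Icc]
      omega
  have h := Multipliable.tprod_finset_bUnion_disjoint hdisj hmult
  rw [tprod_congr_set_coe F hunion] at h
  refine Eq.trans (prod_congr rfl fun r hr => ?_) h.symm
  rw [Cr, ← (multipliable_Cr q g r hr).tprod_pow]
  exact tprod_congr fun p => (hFt r hr p).symm

/-! ### Mertens' third theorem in the residue class `1` -/

theorem primeProduct_eq_exp (q : ℕ) (x : ℝ) :
    primeProduct q x = Real.exp (-∑ n ∈ Icc 0 ⌊x⌋₊, primeWeight q n) := by
  have hI : Iic ⌊x⌋₊ = Icc 0 ⌊x⌋₊ := by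
    ext
    simp
  rw [primeProduct, hI, ← sum_neg_distrib, Real.exp_sum, prod_filter]
  refine prod_congr rfl fun n _ => ?_
  unfold primeWeight
  split_ifs with h
  · have hn : 1 / (n : ℝ) ≤ 1 / 2 :=
      one_div_le_one_div_of_le (by norm_num) (by exact_mod_cast h.1.two_le)
    rw [neg_neg, Real.exp_log (by linarith)]
  · simp

theorem abs_exp_sub_one_le_mul_exp (t : ℝ) : |Real.exp t - 1| ≤ |t| * Real.exp |t| := by
  rcases le_total 0 t with h | h
  · have h1 := Real.add_one_le_exp (-t)
    have h2 := Real.add_one_le_exp t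
    have h3 : Real.exp t * Real.exp (-t) = 1 := by rw [← Real.exp_add, add_neg_cancel, Real.exp_zero]
    rw [abs_of_nonneg h, abs_of_nonneg (by linarith)]
    nlinarith [Real.exp_pos t]
  · have h1 := Real.add_one_le_exp t
    have h2 : Real.exp t ≤ 1 := Real.exp_le_one_iff.2 h
    have h3 : 1 ≤ Real.exp (-t) := Real.one_le_exp (by linarith)
    rw [abs_of_nonpos h, abs_of_nonpos (by linarith)]
    nlinarith

theorem main_term_eq_exp {q : ℕ} (hq : q.Prime) {M x : ℝ} (hx : 2 ≤ x)
    (hM : ((q : ℝ) - 1) * M = Real.eulerMascheroniConstant + Real.log (alpha q) +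
      Real.log (1 - 1 / (q : ℝ)) + Real.log (C1 q)) :
    ((q : ℝ) * Real.exp (-Real.eulerMascheroniConstant) /
      (((q : ℝ) - 1) * alpha q * C1 q * Real.log x)) ^ (1 / ((q : ℝ) - 1)) =
      Real.exp (-(1 / ((q : ℝ) - 1) * Real.log (Real.log x) + M)) := by
  have hq0 : (1 : ℝ) < q := by exact_mod_cast hq.one_lt
  have hq1 : (0 : ℝ) < q - 1 := by linarith
  have hα : 0 < alpha q := by
    rw [alpha_eq]
    exact NumberField.dedekindZeta_residue_pos _
  have hC := C1_pos q
  have hlog : 0 < Real.log x := Real.log_pos (by linarith)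
  have hlq : Real.log (1 - 1 / (q : ℝ)) = Real.log (q - 1) - Real.log q := by
    rw [← Real.log_div hq1.ne' (by linarith)]
    congr 1
    field_simp
  rw [Real.rpow_def_of_pos (by positivity), Real.log_div (by positivity) (by positivity),
    Real.log_mul (by positivity) (by positivity), Real.log_exp,
    Real.log_mul (by positivity) hlog.ne', Real.log_mul (by positivity) hC.ne',
    Real.log_mul hq1.ne' hα.ne']
  congr 1
  rw [hlq] at hM
  field_simp
  linarith

end MertensAP

theorem mainTheorem6 (q : ℕ) (hq : q.Prime) (hq2 : q ≠ 2) :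
    ∃ K : ℝ, ∀ g : ℕ, IsPrimitiveRoot (g : ZMod q) (q - 1) →
      MertensAP.C q g = MertensAP.C1 q ∧
      ∃ E : ℝ → ℝ, ∀ x : ℝ, 2 ≤ x →
        |E x| ≤ K / Real.log x ∧
        MertensAP.primeProduct q x =
          ((q : ℝ) * Real.exp (-Real.eulerMascheroniConstant) /
            (((q : ℝ) - 1) * MertensAP.alpha q * MertensAP.C q g * Real.log x)) ^
              (1 / ((q : ℝ) - 1)) * (1 + E x) := by
  obtain ⟨M, K, hK⟩ := MertensAP.exists_abs_sum_primeWeight_sub_le hq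
  have hlim : Filter.Tendsto (fun x : ℝ => ∑ n ∈ Finset.Icc 0 ⌊x⌋₊, MertensAP.primeWeight q n -
      1 / ((q : ℝ) - 1) * Real.log (Real.log x)) Filter.atTop (nhds M) := by
    rw [tendsto_iff_norm_sub_tendsto_zero]
    refine squeeze_zero' (Filter.Eventually.of_forall fun _ => norm_nonneg _)
      (Filter.eventually_atTop.2 ⟨2, fun x hx => hK x hx⟩)
      (Real.tendsto_log_atTop.const_div_atTop K)
  have hM := MertensAP.mertens_constant hq hlim
  -- the relative error is `exp t - 1` with `|t| ≤ K / log x ≤ K / log 2`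
  refine ⟨K * Real.exp (K / Real.log 2), fun g hg => ?_⟩
  rw [MertensAP.C_eq_C1 hq hg]
  refine ⟨rfl, fun x => Real.exp (-(∑ n ∈ Finset.Icc 0 ⌊x⌋₊, MertensAP.primeWeight q n -
    1 / ((q : ℝ) - 1) * Real.log (Real.log x) - M)) - 1, fun x hx => ⟨?_, ?_⟩⟩
  · have hlog2 : 0 < Real.log 2 := Real.log_pos one_lt_two
    have hlog : Real.log 2 ≤ Real.log x := Real.log_le_log two_pos hx
    have he := hK x hx
    have hK0 : 0 ≤ K := by
      have := (abs_nonneg _).trans he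
      by_contra hneg
      exact absurd this (not_le.2 (div_neg_of_neg_of_pos (not_le.1 hneg) (by linarith)))
    refine (MertensAP.abs_exp_sub_one_le_mul_exp _).trans ?_
    rw [abs_neg]
    calc _ ≤ K / Real.log x * Real.exp (K / Real.log 2) := by
          refine mul_le_mul he (Real.exp_le_exp.2 (he.trans ?_)) (Real.exp_pos _).le (div_nonneg hK0 (by linarith))
          gcongr
      _ = _ := by ring
  · rw [MertensAP.main_term_eq_exp hq hx hM, MertensAP.primeProduct_eq_exp, add_sub_cancel,
      ← Real.exp_add]
    congr 1
    ring
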